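/- Let $M$ be a smooth $3$-dimensional Riemannian manifold of constant sectional curvature $\rho\in\mathbb R$ (for instance a space form $M^3(\rho)$, that is $\mathbb R^3$, $\mathbb S^3(\rho)$ or $\mathbb H^3(\rho)$), with Levi-Civita connection $\nabla$ and curvature tensor $R(X,Y)Z=\nabla_X\nabla_YZ-\nabla_Y\nabla_XZ-\nabla_{[X,Y]}Z$. Let $J\subset\mathbb R$ be an open interval and let $\gamma:J\to M$ be a smooth arc-length parametrized curve, $T=\gamma'$, which is triharmonic, i.e. $$\nabla_T^5T+R(\nabla_T^3T,T)T-R(\nabla_T^2T,\nabla_TT)T=0 ,$$ and proper, i.e. $\nabla_TT$ does not vanish identically on $J$. Let $\kappa=\lVert\nabla_TT\rVert$ be the curvature of $\gamma$. On $\{s\in J:\kappa(s)\neq0\}$ let $N=\nabla_TT/\kappa$ be the principal normal, let $B$ be a smooth unit vector field along $\gamma$ orthogonal to $T$ and $N$ (the binormal), and let $\tau=\langle\nabla_TN,B\rangle$ be the torsion, so that $\nabla_TN=-\kappa T+\tau B$. Then $\kappa$ is constant on $J$ if and only if $\tau$ is constant on $\{s\in J:\kappa(s)\neq 0\}$. 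-/

import Mathlib

open Bundle Set
open scoped Manifold ContDiff

noncomputable section

namespace TriharmonicCurves

section Connection

variable {E : Type*} [NormedAddCommGroup E] [NormedSpace ℝ E] [FiniteDimensional ℝ E]
  {H : Type*} [TopologicalSpace H] {I : ModelWithCorners ℝ E H}
  {M : Type*} [TopologicalSpace M] [ChartedSpace H M] [IsManifold I ∞ M]

/-- The curvature tensor `R(u, v) w = ∇_X ∇_Y Z - ∇_Y ∇_X Z - ∇_[X, Y] Z` at the point `p`, where
`X`, `Y`, `Z` are the vector fields extending the tangent vectors `u`, `v`, `w` at `p` that have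
constant coefficients in the coordinate frame of the preferred chart at `p`.
Recall that `cov σ x (X x)` is `∇_X σ` at `x`. -/
def curvatureTensor (cov : CovariantDerivative I E (TangentSpace I : M → Type _)) {p : M}
    (u v w : TangentSpace I p) : TangentSpace I p :=
  let X : ∀ q : M, TangentSpace I q := FiberBundle.extend E u
  let Y : ∀ q : M, TangentSpace I q := FiberBundle.extend E v
  let Z : ∀ q : M, TangentSpace I q := FiberBundle.extend E w
  cov (fun q ↦ cov Z q (Y q)) p (X p) - cov (fun q ↦ cov Z q (X q)) p (Y p)
    - cov Z p (VectorField.mlieBracket I X Y p)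

variable (I) in
/-- The velocity field `T = γ'` of a curve. -/
def velocity (γ : ℝ → M) (s : ℝ) : TangentSpace I (γ s) :=
  mfderiv 𝓘(ℝ, ℝ) I γ s (1 : ℝ)

/-- The covariant derivative `∇_T V` of a vector field `V` along the curve `γ`. If `E_i` is the
coordinate frame of the preferred chart at `γ s` and `V = ∑ i, v_i • E_i ∘ γ` near `s`, this is
`∑ i, v_i'(s) • E_i + ∑ i, v_i(s) • ∇_{γ'(s)} E_i`: the first term differentiates the coordinates
of `V`, and the second one is `∇_{γ'(s)}` of the field `∑ i, v_i(s) • E_i`, which has constant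
coefficients. -/
def covDerivAlong (cov : CovariantDerivative I E (TangentSpace I : M → Type _)) (γ : ℝ → M)
    (V : ∀ s, TangentSpace I (γ s)) (s : ℝ) : TangentSpace I (γ s) :=
  let e := trivializationAt E (TangentSpace I : M → Type _) (γ s)
  e.symmL ℝ (γ s) (deriv (fun t ↦ (e ⟨γ t, V t⟩).2) s)
    + cov (FiberBundle.extend E (V s)) (γ s) (velocity I γ s)

/-- The iterated covariant derivative `∇_T^k T` of the velocity field of `γ`. -/
def iterCov (cov : CovariantDerivative I E (TangentSpace I : M → Type _)) (γ : ℝ → M) (k : ℕ) :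
    ∀ s, TangentSpace I (γ s) :=
  (covDerivAlong cov γ)^[k] (velocity I γ)

/-- The field `τ₃(γ) = ∇_T^5 T + R(∇_T^3 T, T) T - R(∇_T^2 T, ∇_T T) T` along `γ`. -/
def triTension (cov : CovariantDerivative I E (TangentSpace I : M → Type _)) (γ : ℝ → M) (s : ℝ) :
    TangentSpace I (γ s) :=
  iterCov cov γ 5 s
    + curvatureTensor cov (iterCov cov γ 3 s) (iterCov cov γ 0 s) (iterCov cov γ 0 s)
    - curvatureTensor cov (iterCov cov γ 2 s) (iterCov cov γ 1 s) (iterCov cov γ 0 s)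

variable [RiemannianBundle (fun x : M ↦ TangentSpace I x)]
  [IsContMDiffRiemannianBundle I ∞ E (fun x : M ↦ TangentSpace I x)]

/-- `cov` is the Levi-Civita connection: the (smooth) affine connection which is compatible with
the Riemannian metric, `u⟨Y, Z⟩ = ⟨∇_u Y, Z⟩ + ⟨Y, ∇_u Z⟩` for all vector fields `Y`, `Z` that are
differentiable at the base point `p` of `u`, and which has no torsion. -/
structure IsLeviCivita (cov : CovariantDerivative I E (TangentSpace I : M → Type _)) : Prop where
  smooth : CovariantDerivative.ContMDiffCovariantDerivative cov ∞
  metric : ∀ (Y Z : ∀ q : M, TangentSpace I q) (p : M) (u : TangentSpace I p),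
    MDifferentiableAt I I.tangent (fun q ↦ (⟨q, Y q⟩ : TangentBundle I M)) p →
    MDifferentiableAt I I.tangent (fun q ↦ (⟨q, Z q⟩ : TangentBundle I M)) p →
    mvfderiv I (fun q ↦ inner ℝ (Y q) (Z q)) p u =
      inner ℝ (cov Y p u) (Z p) + inner ℝ (Y p) (cov Z p u)
  torsionFree : cov.torsion = 0

/-- The sectional curvature of the plane spanned by the linearly independent vectors `u`, `v`. -/
def sectionalCurvature (cov : CovariantDerivative I E (TangentSpace I : M → Type _)) {p : M}
    (u v : TangentSpace I p) : ℝ :=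
  inner ℝ (curvatureTensor cov u v v) u / (inner ℝ u u * inner ℝ v v - inner ℝ u v ^ 2)

/-- All tangent planes have sectional curvature `ρ`. -/
def HasConstantSectionalCurvature (cov : CovariantDerivative I E (TangentSpace I : M → Type _))
    (ρ : ℝ) : Prop :=
  ∀ (p : M) (u v : TangentSpace I p), LinearIndependent ℝ ![u, v] → sectionalCurvature cov u v = ρ

/-- `γ` is an arc-length parametrized smooth triharmonic curve on `J`. -/
structure IsTriharmonicCurve (cov : CovariantDerivative I E (TangentSpace I : M → Type _))
    (J : Set ℝ) (γ : ℝ → M) : Prop where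
  smooth : ContMDiffOn 𝓘(ℝ, ℝ) I ∞ γ J
  unitSpeed : ∀ s ∈ J, ‖velocity I γ s‖ = 1
  triharmonic : ∀ s ∈ J, triTension cov γ s = 0

/-- `γ` is harmonic on `J`, that is, a geodesic: `∇_T T = 0`. -/
def IsHarmonicCurve (cov : CovariantDerivative I E (TangentSpace I : M → Type _))
    (J : Set ℝ) (γ : ℝ → M) : Prop :=
  ∀ s ∈ J, iterCov cov γ 1 s = 0

/-- A proper triharmonic curve: triharmonic and not harmonic. -/
def IsProperTriharmonicCurve (cov : CovariantDerivative I E (TangentSpace I : M → Type _))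
    (J : Set ℝ) (γ : ℝ → M) : Prop :=
  IsTriharmonicCurve cov J γ ∧ ¬ IsHarmonicCurve cov J γ

/-- The curvature `κ = ‖∇_T T‖`. -/
def curvature (cov : CovariantDerivative I E (TangentSpace I : M → Type _)) (γ : ℝ → M) (s : ℝ) :
    ℝ :=
  ‖iterCov cov γ 1 s‖

/-- The principal normal `N = ∇_T T / κ`, meaningful where `κ ≠ 0`. -/
def normal (cov : CovariantDerivative I E (TangentSpace I : M → Type _)) (γ : ℝ → M) (s : ℝ) :
    TangentSpace I (γ s) :=
  (curvature cov γ s)⁻¹ • iterCov cov γ 1 s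

/-- The part of `J` on which `κ ≠ 0`, so that the Frenet frame is defined. -/
def frenetSet (cov : CovariantDerivative I E (TangentSpace I : M → Type _)) (J : Set ℝ)
    (γ : ℝ → M) : Set ℝ :=
  {s ∈ J | curvature cov γ s ≠ 0}

/-- `B` is a binormal field of `γ`: a smooth unit field along `γ`, orthogonal to `T` and `N`,
defined where `κ ≠ 0`. In dimension three `B` is unique up to sign on each interval. -/
structure IsBinormal (cov : CovariantDerivative I E (TangentSpace I : M → Type _)) (J : Set ℝ)
    (γ : ℝ → M) (B : ∀ s, TangentSpace I (γ s)) : Prop where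
  smooth : ContMDiffOn 𝓘(ℝ, ℝ) I.tangent ∞ (fun s ↦ (⟨γ s, B s⟩ : TangentBundle I M))
    (frenetSet cov J γ)
  unit : ∀ s ∈ frenetSet cov J γ, ‖B s‖ = 1
  orthTangent : ∀ s ∈ frenetSet cov J γ, inner ℝ (B s) (velocity I γ s) = 0
  orthNormal : ∀ s ∈ frenetSet cov J γ, inner ℝ (B s) (normal cov γ s) = 0

/-- The torsion `τ = ⟨∇_T N, B⟩`, the coefficient in `∇_T N = -κ T + τ B`. -/
def torsion (cov : CovariantDerivative I E (TangentSpace I : M → Type _)) (γ : ℝ → M)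
    (B : ∀ s, TangentSpace I (γ s)) (s : ℝ) : ℝ :=
  inner ℝ (covDerivAlong cov γ (normal cov γ) s) (B s)

end Connection

end TriharmonicCurves

end

/-! Constant sectional curvature forces $R(u,v)w=\rho(\langle v,w\rangle u-\langle u,w\rangle v)$
(`IsLeviCivita.curvatureTensor_of_const`). Expanding $\nabla_T^kT$ in the Frenet frame turns
triharmonicity into scalar equations, of which only the $T$- and $N$-components are needed
(`IsTriharmonicCurve.frenet_equations`). The curvature terms have no $T$-component, so that equation
is free of $\rho$:
$2\kappa'\kappa''+\kappa\kappa'''-2\kappa^3\kappa'-\kappa\kappa'\tau^2-\kappa^2\tau\tau'=0$.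

If $\kappa$ is constant, it is nonzero by properness, so the frame exists on all of $J$ and the
$T$-equation reduces to $\tau\tau'=0$. Thus $\tau^2$ is constant, and so is $\tau$ by continuity.

If $\tau$ is constant, the $T$-equation integrates twice, expressing $\kappa\kappa'^2$ and
$\kappa^2\kappa''$ as polynomials in $\kappa$. Eliminating all derivatives from the $N$-equation
leaves $F(\kappa)=0$ for a polynomial $F$ whose coefficient in degree 10 is $-126/25$, whatever
$\rho$, $\tau$ and the integration constants are. So $\kappa$ takes finitely many values locally,
and is locally constant where it is nonzero (`curvature_ode_const`). A connectedness argument then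
shows that $\kappa$ cannot drop to zero inside $J$.

The remaining work is geometric: symmetries of the curvature tensor, and Leibniz rule, smoothness
and metric compatibility for the covariant derivative along a curve. -/

noncomputable section

set_option linter.unusedSectionVars false

namespace TriharmonicCurves

open Filter Topology FiberBundle

/-! ### Coordinate extensions of tangent vectors, and locality of smooth connections. -/

section Extend

variable {E : Type*} [NormedAddCommGroup E] [NormedSpace ℝ E] [FiniteDimensional ℝ E]
  {H : Type*} [TopologicalSpace H] {I : ModelWithCorners ℝ E H}
  {M : Type*} [TopologicalSpace M] [ChartedSpace H M] [IsManifold I ∞ M]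

lemma extend_eq_symmL {p q : M} (u : TangentSpace I p)
    (hq : q ∈ (trivializationAt E (TangentSpace I : M → Type _) p).baseSet) :
    extend E u q = (trivializationAt E (TangentSpace I : M → Type _) p).symmL ℝ q
      ((trivializationAt E (TangentSpace I : M → Type _) p).continuousLinearMapAt ℝ p u) := by
  rw [Trivialization.symmL_apply _ hq, Trivialization.continuousLinearMapAt_apply_of_mem ℝ _
    (mem_baseSet_trivializationAt E (TangentSpace I : M → Type _) p)]
  simp only [extend]

lemma eventually_mem_baseSet (p : M) :
    ∀ᶠ q in 𝓝 p, q ∈ (trivializationAt E (TangentSpace I : M → Type _) p).baseSet :=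
  (trivializationAt E (TangentSpace I : M → Type _) p).open_baseSet.mem_nhds
    (mem_baseSet_trivializationAt E (TangentSpace I : M → Type _) p)

lemma eventually_extend_add {p : M} (u v : TangentSpace I p) :
    ∀ᶠ q in 𝓝 p, (extend E (u + v) q : TangentSpace I q) = (extend E u + extend E v) q := by
  filter_upwards [eventually_mem_baseSet (I := I) p] with q hq
  simp only [Pi.add_apply, extend_eq_symmL _ hq, map_add]

lemma eventually_extend_smul {p : M} (a : ℝ) (u : TangentSpace I p) :
    ∀ᶠ q in 𝓝 p, (extend E (a • u) q : TangentSpace I q) = (a • extend E u) q := by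
  filter_upwards [eventually_mem_baseSet (I := I) p] with q hq
  simp only [Pi.smul_apply, extend_eq_symmL _ hq, map_smul]

/-- The extension of a tangent vector is smooth on the domain of the preferred chart. -/
lemma contMDiffOn_extend {p : M} (u : TangentSpace I p) :
    ContMDiffOn I I.tangent ∞ (fun q ↦ (⟨q, extend E u q⟩ : TangentBundle I M))
      (trivializationAt E (TangentSpace I : M → Type _) p).baseSet := by
  rw [Trivialization.contMDiffOn_section_baseSet_iff]
  refine (contMDiffOn_const
    (c := ((trivializationAt E (TangentSpace I : M → Type _) p) ⟨p, u⟩).2)).congr ?_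
  intro q hq
  simp only [extend]
  rw [Trivialization.apply_mk_symm _ hq]

lemma eventually_contMDiffAt_extend {p : M} (u : TangentSpace I p) :
    ∀ᶠ r in 𝓝 p, ContMDiffAt I I.tangent ∞ (fun q ↦ (⟨q, extend E u q⟩ : TangentBundle I M)) r := by
  filter_upwards [(trivializationAt E (TangentSpace I : M → Type _) p).open_baseSet.mem_nhds
    (mem_baseSet_trivializationAt E (TangentSpace I : M → Type _) p)] with r hr
  exact (contMDiffOn_extend u).contMDiffAt
    ((trivializationAt E (TangentSpace I : M → Type _) p).open_baseSet.mem_nhds hr)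

variable [T2Space M]

/-- A smooth connection maps locally smooth vector fields to smooth sections of `Hom(TM, TM)`. -/
lemma contMDiffAt_cov {cov : CovariantDerivative I E (TangentSpace I : M → Type _)}
    (hcov : CovariantDerivative.ContMDiffCovariantDerivative cov ∞) {σ : ∀ q : M, TangentSpace I q}
    {p : M} (hσ : ∀ᶠ r in 𝓝 p,
      ContMDiffAt I I.tangent ∞ (fun q ↦ (⟨q, σ q⟩ : TangentBundle I M)) r) :
    ContMDiffAt I (I.prod 𝓘(ℝ, E →L[ℝ] E)) ∞
      (fun q ↦ TotalSpace.mk' (E →L[ℝ] E)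
        (E := fun q : M ↦ TangentSpace I q →L[ℝ] TangentSpace I q) q (cov σ q)) p := by
  obtain ⟨U, hU, hUo, hpU⟩ := eventually_nhds_iff.1 hσ
  obtain ⟨f, -, hf⟩ := (SmoothBumpFunction.nhds_basis_tsupport (I := I) p).mem_iff.1
    (hUo.mem_nhds hpU)
  -- Smoothness of the connection is given for global fields. A bump function equal to 1 near `p`
  -- makes `σ` global, and locality of `cov` removes it again.
  have hglob : ContMDiff I I.tangent ∞
      (fun q ↦ (⟨q, ((f : M → ℝ) • σ) q⟩ : TangentBundle I M)) :=
    ContMDiffOn.smul_section_of_tsupport f.contMDiff.contMDiffOn hUo hf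
      (fun q hq ↦ (hU q hq).contMDiffWithinAt)
  have h1 := (hcov.contMDiff.contMDiff (σ := (f : M → ℝ) • σ)
    (by simpa using hglob.contMDiffOn)).contMDiffAt (x := p) univ_mem
  refine h1.congr_of_eventuallyEq ?_
  filter_upwards [eventually_eventually_nhds.2 f.eventuallyEq_one, hUo.mem_nhds hpU] with q hq hqU
  have h2 : cov σ q = cov ((f : M → ℝ) • σ) q := by
    refine cov.isCovariantDerivativeOnUniv.congr_of_eventuallyEq
      ((hU q hqU).mdifferentiableAt (by simp))
      ((hglob q).mdifferentiableAt (by simp)) univ_mem ?_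
    filter_upwards [hq] with r hr
    simp [hr]
  simp only [h2]

lemma eventually_contMDiffAt_cov_apply
    {cov : CovariantDerivative I E (TangentSpace I : M → Type _)}
    (hcov : CovariantDerivative.ContMDiffCovariantDerivative cov ∞)
    {σ X : ∀ q : M, TangentSpace I q}
    {p : M} (hσ : ∀ᶠ r in 𝓝 p, ContMDiffAt I I.tangent ∞ (fun q ↦ (⟨q, σ q⟩ : TangentBundle I M)) r)
    (hX : ∀ᶠ r in 𝓝 p, ContMDiffAt I I.tangent ∞ (fun q ↦ (⟨q, X q⟩ : TangentBundle I M)) r) :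
    ∀ᶠ r in 𝓝 p, ContMDiffAt I I.tangent ∞
      (fun q ↦ (⟨q, cov σ q (X q)⟩ : TangentBundle I M)) r := by
  filter_upwards [eventually_eventually_nhds.2 hσ, hX] with r hr hXr
  exact (contMDiffAt_cov hcov hr).clm_bundle_apply hXr

end Extend

/-! ### Algebraic curvature tensors and sectional curvature. -/

section Algebraic

variable {V : Type*} [NormedAddCommGroup V] [InnerProductSpace ℝ V]

/-- The algebraic properties of the Riemann curvature tensor at a point. -/
structure IsAlgebraicCurvature (R : V → V → V → V) : Prop where
  add_left : ∀ u u' v w, R (u + u') v w = R u v w + R u' v w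
  add_right : ∀ u v w w', R u v (w + w') = R u v w + R u v w'
  swap : ∀ u v w, R u v w = -R v u w
  inner_self : ∀ u v w, inner ℝ (R u v w) w = 0
  bianchi : ∀ u v w, R u v w + R v w u + R w u v = 0

namespace IsAlgebraicCurvature

variable {R : V → V → V → V} (hR : IsAlgebraicCurvature R)
include hR

lemma add_middle (u v v' w : V) : R u (v + v') w = R u v w + R u v' w := by
  rw [hR.swap, hR.add_left, hR.swap v, hR.swap v']; abel

lemma inner_swap (u v w z : V) : inner ℝ (R u v w) z = -inner ℝ (R u v z) w := by
  have h := hR.inner_self u v (w + z)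
  rw [hR.add_right, inner_add_left, inner_add_right, inner_add_right, hR.inner_self,
    hR.inner_self] at h
  linarith

lemma inner_bianchi (u v w z : V) :
    inner ℝ (R u v w) z + inner ℝ (R v w u) z + inner ℝ (R w u v) z = 0 := by
  rw [← inner_add_left, ← inner_add_left, hR.bianchi, inner_zero_left]

lemma inner_swap_left (u v w z : V) : inner ℝ (R u v w) z = -inner ℝ (R v u w) z := by
  rw [hR.swap, inner_neg_left]

/-- The classical octahedron argument: combine the four Bianchi identities for the cyclic shifts of
`u, v, w, z`, cancelling terms by the two skew symmetries. -/
lemma inner_pair_symm (u v w z : V) : inner ℝ (R u v w) z = inner ℝ (R w z u) v := by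
  have h1 := hR.inner_bianchi u v w z
  have h2 := hR.inner_bianchi v w z u
  have h3 := hR.inner_bianchi w z u v
  have h4 := hR.inner_bianchi z u v w
  have a1 := hR.inner_swap v w u z
  have a2 := hR.inner_swap w u v z
  have a3 := hR.inner_swap u v w z
  have a4 := hR.inner_swap z u v w
  have a5 := hR.inner_swap w z u v
  have a6 := hR.inner_swap v z u w
  have b1 := hR.inner_swap_left w u v z
  have b2 := hR.inner_swap_left z v w u
  have b3 := hR.inner_swap_left u w z v
  have b4 := hR.inner_swap_left v z u w
  have b5 := hR.inner_swap w u z v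
  have b6 := hR.inner_swap z v w u
  linarith

/-- A curvature tensor all of whose sectional curvatures vanish is zero; applied to a difference of
two curvature tensors, this says that the sectional curvatures determine the curvature tensor. -/
lemma eq_zero (h0 : ∀ u v, inner ℝ (R u v v) u = 0) (u v w : V) : R u v w = 0 := by
  -- Polarization in `u`: the two cross terms agree by pair symmetry.
  have h1 : ∀ u v z, inner ℝ (R u v v) z = 0 := by
    intro u v z
    have h := h0 (u + z) v
    rw [hR.add_left, inner_add_left, inner_add_right, inner_add_right, h0, h0,
      hR.inner_pair_symm z v v u] at h
    have := hR.inner_swap_left v u z v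
    have := hR.inner_swap u v z v
    linarith
  -- Polarization in `v`. Being skew in the last two slots as well as the first two, `R` has three
  -- equal terms in its Bianchi sum.
  have h2 : ∀ u v w z, inner ℝ (R u v w) z = -inner ℝ (R u w v) z := by
    intro u v w z
    have h := h1 u (v + w) z
    rw [hR.add_middle, hR.add_right, hR.add_right, inner_add_left, inner_add_left,
      inner_add_left, h1, h1] at h
    linarith
  refine ext_inner_right ℝ fun z ↦ ?_
  rw [inner_zero_left]
  have := hR.inner_bianchi u v w z
  have := h2 v w u z
  have := h2 u v w z
  have := hR.inner_swap_left v u w z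
  have := hR.inner_swap_left w u v z
  linarith

/-- A curvature tensor with constant sectional curvature. -/
lemma eq_of_sectional {ρ : ℝ}
    (hs : ∀ u v : V, LinearIndependent ℝ ![u, v] →
      inner ℝ (R u v v) u / (inner ℝ u u * inner ℝ v v - inner ℝ u v ^ 2) = ρ)
    (hsmul : ∀ (a : ℝ) u v w, R (a • u) v w = a • R u v w) (u v w : V) :
    R u v w = ρ • ((inner ℝ v w : ℝ) • u - (inner ℝ u w : ℝ) • v) := by
  have key : IsAlgebraicCurvature
      fun u v w : V ↦ R u v w - ρ • ((inner ℝ v w : ℝ) • u - (inner ℝ u w : ℝ) • v) := by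
    refine ⟨fun u u' v w ↦ ?_, fun u v w w' ↦ ?_, fun u v w ↦ ?_, fun u v w ↦ ?_,
      fun u v w ↦ ?_⟩
    · simp only [hR.add_left, inner_add_left]; module
    · simp only [hR.add_right, inner_add_right]; module
    · rw [hR.swap]; module
    · simp only [inner_sub_left, hR.inner_self, inner_smul_left, conj_trivial]; ring
    · simp only [real_inner_comm w v, real_inner_comm w u, real_inner_comm v u]
      rw [eq_neg_of_add_eq_zero_left ((add_assoc _ _ _).symm.trans (hR.bianchi u v w))]
      module
  have hself : ∀ v w, R v v w = 0 := fun v w ↦ by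
    have h2 : (2 : ℝ) • R v v w = 0 := by
      rw [two_smul]; nth_rewrite 1 [hR.swap]; exact neg_add_cancel _
    simpa using h2
  refine sub_eq_zero.1 (key.eq_zero (fun u v ↦ ?_) u v w)
  rw [inner_sub_left, inner_smul_left, inner_sub_left, inner_smul_left, inner_smul_left]
  simp only [conj_trivial]
  by_cases hli : LinearIndependent ℝ ![u, v]
  · have h := hs u v hli
    -- Equality in Cauchy–Schwarz: the squared norm of $|v|^2u-\langle u,v\rangle v$ is $|v|^2$
    -- times the Gram determinant.
    have hne : (inner ℝ u u * inner ℝ v v - inner ℝ u v ^ 2 : ℝ) ≠ 0 := by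
      intro h0
      rw [LinearIndependent.pair_iff] at hli
      have hw : (inner ℝ v v : ℝ) • u + (-inner ℝ u v : ℝ) • v = 0 := by
        rw [← inner_self_eq_zero (𝕜 := ℝ)]
        simp only [inner_add_left, inner_add_right, inner_smul_left, inner_smul_right,
          conj_trivial, real_inner_comm u v]
        linear_combination (inner ℝ v v : ℝ) * h0
      have hv : v = 0 := inner_self_eq_zero.1 (hli _ _ hw).1
      simpa using hli 0 1 (by simp [hv])
    rw [div_eq_iff hne] at h
    rw [h, real_inner_comm v u]; ring
  -- The hypothesis is silent about dependent pairs; there `R` and the model tensor both vanish, by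
  -- homogeneity and skew symmetry.
  · rw [LinearIndependent.pair_iff] at hli
    push Not at hli
    obtain ⟨a, b, hab, hne⟩ := hli
    by_cases ha : a = 0
    · have hv : v = (0 : ℝ) • u := by
        simpa [ha, hne ha] using hab
      rw [hR.swap, hv, hsmul]
      simp
    · have hu : u = (-(a⁻¹ * b)) • v := by
        rw [neg_smul, mul_smul, eq_neg_iff_add_eq_zero, ← inv_smul_smul₀ ha u, ← smul_add, hab,
          smul_zero]
      rw [hu, hsmul, hself]
      simp only [inner_smul_left, inner_smul_right, inner_zero_left, smul_zero, conj_trivial]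
      ring

end IsAlgebraicCurvature

end Algebraic

/-! ### Symmetries of the Riemann tensor of a Levi-Civita connection. -/

section Curvature

variable {E : Type*} [NormedAddCommGroup E] [NormedSpace ℝ E] [FiniteDimensional ℝ E]
  {H : Type*} [TopologicalSpace H] {I : ModelWithCorners ℝ E H} [I.Boundaryless]
  {M : Type*} [TopologicalSpace M] [ChartedSpace H M] [IsManifold I ∞ M]

/-- The coordinates of the extension of a tangent vector in the preferred chart are constant. -/
lemma mfderiv_extChartAt_extend {p q : M} (u : TangentSpace I p)
    (hq : q ∈ (chartAt H p).source) :
    mfderiv I 𝓘(ℝ, E) (extChartAt I p) q (extend E u q) =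
      (trivializationAt E (TangentSpace I : M → Type _) p).continuousLinearMapAt ℝ p u := by
  have hq' : q ∈ (trivializationAt E (TangentSpace I : M → Type _) p).baseSet := by simpa using hq
  rw [← TangentBundle.continuousLinearMapAt_trivializationAt hq, extend_eq_symmL _ hq']
  exact Trivialization.continuousLinearMapAt_symmL _ hq' _

lemma mvfderiv_comp_extChartAt {p q : M} {f : M → ℝ} {g : E → ℝ}
    (hq : q ∈ (chartAt H p).source) (hg : DifferentiableAt ℝ g (extChartAt I p q))
    (hfg : f =ᶠ[𝓝 q] g ∘ extChartAt I p) (u : TangentSpace I p) :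
    mvfderiv I f q (extend E u q) = fderiv ℝ g (extChartAt I p q)
      ((trivializationAt E (TangentSpace I : M → Type _) p).continuousLinearMapAt ℝ p u) := by
  have h := (hg.hasFDerivAt.hasMFDerivAt.comp q
    (mdifferentiableAt_extChartAt (I := I) hq).hasMFDerivAt).congr_of_eventuallyEq hfg
  rw [← mfderiv_extChartAt_extend u hq]
  simp only [mvfderiv, h.mfderiv]
  rfl

lemma mvfderiv_congr {p : M} {f g : M → ℝ} (h : f =ᶠ[𝓝 p] g) :
    mvfderiv I f p = mvfderiv I g p := by
  ext u
  exact congrArg (fun L : TangentSpace I p →L[ℝ] ℝ ↦ L u) (h.mfderiv_eq (I := I) (I' := 𝓘(ℝ, ℝ)))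

/-- Derivatives of a smooth function along coordinate fields commute. -/
lemma mvfderiv_extend_comm {p : M} {f : M → ℝ} (hf : ContMDiffAt I 𝓘(ℝ, ℝ) ∞ f p)
    (u v : TangentSpace I p) :
    mvfderiv I (fun q ↦ mvfderiv I f q (extend E u q)) p v =
      mvfderiv I (fun q ↦ mvfderiv I f q (extend E v q)) p u := by
  set φ := extChartAt I p with hφ
  set g : E → ℝ := f ∘ φ.symm with hg
  have hgs : ContDiffAt ℝ 2 g (φ p) := by
    have := (contMDiffAt_iff.1 (hf.of_le (m := 2) ENat.LEInfty.out)).2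
    simpa [I.range_eq_univ, contDiffWithinAt_univ] using! this
  have hgd : ∀ᶠ q in 𝓝 p, DifferentiableAt ℝ g (φ q) :=
    (continuousAt_extChartAt p).eventually
      ((hgs.eventually (by simp)).mono fun y hy ↦ hy.differentiableAt (by simp))
  have hsrc : ∀ᶠ q in 𝓝 p, q ∈ (chartAt H p).source :=
    (chartAt H p).open_source.mem_nhds (mem_chart_source H p)
  have hfg : ∀ q ∈ (chartAt H p).source, f =ᶠ[𝓝 q] g ∘ φ := fun q hq ↦ by
    filter_upwards [(chartAt H p).open_source.mem_nhds hq] with r hr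
    simp [g, φ, (chartAt H p).left_inv hr]
  set c : TangentSpace I p → E := fun u ↦
    (trivializationAt E (TangentSpace I : M → Type _) p).continuousLinearMapAt ℝ p u
  have hd2 : DifferentiableAt ℝ (fderiv ℝ g) (φ p) :=
    (hgs.fderiv_right (m := 1) (by norm_num)).differentiableAt (by simp)
  -- Coordinate fields are constant in the chart, so the iterated derivative is the second
  -- derivative of `g`, which is symmetric.
  have key : ∀ u v : TangentSpace I p,
      mvfderiv I (fun q ↦ mvfderiv I f q (extend E u q)) p v =
        fderiv ℝ (fderiv ℝ g) (φ p) (c v) (c u) := by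
    intro u v
    have h1 : (fun q ↦ mvfderiv I f q (extend E u q)) =ᶠ[𝓝 p]
        (fun y ↦ fderiv ℝ g y (c u)) ∘ φ := by
      filter_upwards [hsrc, hgd] with q hq hgq
      exact mvfderiv_comp_extChartAt hq hgq (hfg q hq) u
    have h2 := mvfderiv_comp_extChartAt (mem_chart_source H p)
      (hd2.clm_apply (differentiableAt_const (c u))) h1 v
    rw [extend_apply_self] at h2
    rw [h2, fderiv_clm_apply hd2 (differentiableAt_const _)]
    simp [c, φ]
  rw [key, key]
  exact (hgs.isSymmSndFDerivAt (by simp)) _ _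

/-- Both fields are pullbacks of constant fields by the chart, and the bracket is natural under
pullback. This removes the bracket term from the curvature tensor; holding near `p` and not only at
`p`, it also lets the torsion-free identity be differentiated. -/
lemma eventually_mlieBracket_extend {p : M} (u v : TangentSpace I p) :
    ∀ᶠ q in 𝓝 p, VectorField.mlieBracket I (extend E u : ∀ q : M, TangentSpace I q)
      (extend E v : ∀ q : M, TangentSpace I q) q = 0 := by
  have : IsManifold I (minSmoothness ℝ 2) M := by
    rw [minSmoothness_of_isRCLikeNormedField]; infer_instance
  let c : TangentSpace I p → ∀ y : E, TangentSpace 𝓘(ℝ, E) y := fun u _ ↦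
    (trivializationAt E (TangentSpace I : M → Type _) p).continuousLinearMapAt ℝ p u
  have hpull : ∀ u : TangentSpace I p, ∀ q ∈ (chartAt H p).source,
      (extend E u q : TangentSpace I q) =
        VectorField.mpullback I 𝓘(ℝ, E) (extChartAt I p) (c u) q := by
    intro u q hq
    have hinv := isInvertible_mfderiv_extChartAt (I := I) (x := p) (y := q) (by simpa using hq)
    rw [VectorField.mpullback_apply, eq_comm, hinv.inverse_apply_eq]
    exact (mfderiv_extChartAt_extend u hq).symm
  have hdiff : ∀ (u : TangentSpace I p) (y : E), MDifferentiableAt 𝓘(ℝ, E) 𝓘(ℝ, E).tangent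
      (fun y ↦ (⟨y, c u y⟩ : TangentBundle 𝓘(ℝ, E) E)) y := fun u y ↦
    ((contMDiffAt_vectorSpace_iff_contDiffAt (n := 1)).2 contDiffAt_const).mdifferentiableAt
      (by simp)
  filter_upwards [(chartAt H p).open_source.mem_nhds (mem_chart_source H p)] with q hq
  have hev := (chartAt H p).open_source.mem_nhds hq
  rw [Filter.EventuallyEq.mlieBracket_vectorField_eq
    (eventually_of_mem hev (hpull u)) (eventually_of_mem hev (hpull v)),
    ← VectorField.mpullback_mlieBracket (n := ∞) (hdiff u _) (hdiff v _)
      (contMDiffAt_extChartAt' hq) (by simpa using ENat.LEInfty.out), VectorField.mpullback_apply]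
  have h0 : VectorField.mlieBracket 𝓘(ℝ, E) (c u) (c v) (extChartAt I p q) = 0 := by
    rw [← VectorField.mlieBracketWithin_univ, VectorField.mlieBracketWithin_eq_lieBracketWithin,
      VectorField.lieBracketWithin_univ]
    simp [VectorField.lieBracket]
    rfl
  rw [h0, map_zero]

variable [T2Space M] {cov : CovariantDerivative I E (TangentSpace I : M → Type _)}

lemma cov_congr {σ σ' : ∀ q : M, TangentSpace I q} {p : M}
    (hσ : MDifferentiableAt I I.tangent (fun q ↦ (⟨q, σ q⟩ : TangentBundle I M)) p)
    (h : ∀ᶠ q in 𝓝 p, σ' q = σ q) : cov σ' p = cov σ p := by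
  refine cov.isCovariantDerivativeOnUniv.congr_of_eventuallyEq
    (hσ.congr_of_eventuallyEq ?_) hσ univ_mem h
  filter_upwards [h] with q hq
  rw [hq]

lemma mdifferentiableAt_of_eventually {σ : ∀ q : M, TangentSpace I q} {p : M}
    (hσ : ∀ᶠ r in 𝓝 p,
      ContMDiffAt I I.tangent ∞ (fun q ↦ (⟨q, σ q⟩ : TangentBundle I M)) r) :
    MDifferentiableAt I I.tangent (fun q ↦ (⟨q, σ q⟩ : TangentBundle I M)) p :=
  hσ.self_of_nhds.mdifferentiableAt (by simp)

lemma curvatureTensor_eq {p : M} (u v w : TangentSpace I p) :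
    curvatureTensor cov u v w =
      cov (fun q ↦ cov (extend E w) q (extend E v q)) p u
        - cov (fun q ↦ cov (extend E w) q (extend E u q)) p v := by
  simp only [curvatureTensor, (eventually_mlieBracket_extend u v).self_of_nhds, map_zero, sub_zero,
    extend_apply_self]

lemma eventually_contMDiffAt_cov_extend
    (hcov : CovariantDerivative.ContMDiffCovariantDerivative cov ∞) {p : M}
    (v w : TangentSpace I p) :
    ∀ᶠ r in 𝓝 p, ContMDiffAt I I.tangent ∞
      (fun q ↦ (⟨q, cov (extend E w) q (extend E v q)⟩ : TangentBundle I M)) r :=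
  eventually_contMDiffAt_cov_apply hcov (eventually_contMDiffAt_extend w)
    (eventually_contMDiffAt_extend v)

lemma cov_cov_extend_add_left (hcov : CovariantDerivative.ContMDiffCovariantDerivative cov ∞)
    {p : M} (v v' w : TangentSpace I p) :
    cov (fun q ↦ cov (extend E w) q (extend E (v + v') q)) p =
      cov (fun q ↦ cov (extend E w) q (extend E v q)) p
        + cov (fun q ↦ cov (extend E w) q (extend E v' q)) p := by
  have h1 := mdifferentiableAt_of_eventually (eventually_contMDiffAt_cov_extend hcov v w)
  have h2 := mdifferentiableAt_of_eventually (eventually_contMDiffAt_cov_extend hcov v' w)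
  rw [← cov.isCovariantDerivativeOnUniv.add h1 h2]
  refine cov_congr (mdifferentiableAt_add_section h1 h2) ?_
  filter_upwards [eventually_extend_add v v'] with q hq
  simp [hq]

lemma cov_cov_extend_smul_left (hcov : CovariantDerivative.ContMDiffCovariantDerivative cov ∞)
    {p : M} (a : ℝ) (v w : TangentSpace I p) :
    cov (fun q ↦ cov (extend E w) q (extend E (a • v) q)) p =
      a • cov (fun q ↦ cov (extend E w) q (extend E v q)) p := by
  have h1 := mdifferentiableAt_of_eventually (eventually_contMDiffAt_cov_extend hcov v w)
  rw [← cov.isCovariantDerivativeOnUniv.smul_const a h1]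
  refine cov_congr (mdifferentiableAt_const.smul_section h1) ?_
  filter_upwards [eventually_extend_smul a v] with q hq
  simp [hq]

lemma cov_cov_extend_add_right (hcov : CovariantDerivative.ContMDiffCovariantDerivative cov ∞)
    {p : M} (v w w' : TangentSpace I p) :
    cov (fun q ↦ cov (extend E (w + w')) q (extend E v q)) p =
      cov (fun q ↦ cov (extend E w) q (extend E v q)) p
        + cov (fun q ↦ cov (extend E w') q (extend E v q)) p := by
  have h1 := mdifferentiableAt_of_eventually (eventually_contMDiffAt_cov_extend hcov v w)
  have h2 := mdifferentiableAt_of_eventually (eventually_contMDiffAt_cov_extend hcov v w')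
  rw [← cov.isCovariantDerivativeOnUniv.add h1 h2]
  refine cov_congr (mdifferentiableAt_add_section h1 h2) ?_
  -- The inner connection differentiates the extension, so additivity is needed near each nearby
  -- point `q`, not merely at `q`.
  filter_upwards [eventually_eventually_nhds.2 (eventually_extend_add w w'),
    eventually_contMDiffAt_extend w, eventually_contMDiffAt_extend w'] with q hq hw hw'
  have hw := hw.mdifferentiableAt (by simp)
  have hw' := hw'.mdifferentiableAt (by simp)
  rw [cov_congr (mdifferentiableAt_add_section hw hw') hq,
    cov.isCovariantDerivativeOnUniv.add hw hw']
  rfl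

variable [RiemannianBundle (fun x : M ↦ TangentSpace I x)]
  [IsContMDiffRiemannianBundle I ∞ E (fun x : M ↦ TangentSpace I x)]

lemma IsLeviCivita.eventually_cov_extend_comm (hcov : IsLeviCivita cov) {p : M}
    (u v : TangentSpace I p) : ∀ᶠ q in 𝓝 p,
      cov (extend E v) q (extend E u q) = cov (extend E u) q (extend E v q) := by
  filter_upwards [eventually_mlieBracket_extend u v, eventually_contMDiffAt_extend u,
    eventually_contMDiffAt_extend v] with q hq hu hv
  have := cov.torsion_eq_zero_iff.1 hcov.torsionFree (hu.mdifferentiableAt (by simp))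
    (hv.mdifferentiableAt (by simp))
  rwa [hq, sub_eq_zero] at this

/-- Differentiate $|W|^2$ along two coordinate fields $X$, $Y$. By metric compatibility
$X(Y|W|^2)=2\langle\nabla_X\nabla_YW,W\rangle+2\langle\nabla_XW,\nabla_YW\rangle$; the left side and
the last term are symmetric in $X$, $Y$, so antisymmetrizing leaves the claim. -/
lemma IsLeviCivita.inner_curvatureTensor_self (hcov : IsLeviCivita cov) {p : M}
    (u v w : TangentSpace I p) : inner ℝ (curvatureTensor cov u v w) w = 0 := by
  set f : M → ℝ := fun q ↦ inner ℝ (extend E w q : TangentSpace I q) (extend E w q) with hf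
  have hW := eventually_contMDiffAt_extend w
  have hfs : ContMDiffAt I 𝓘(ℝ, ℝ) ∞ f p :=
    ContMDiffAt.inner_bundle (IB := I) (F := E) (E := fun x : M ↦ TangentSpace I x)
      hW.self_of_nhds hW.self_of_nhds
  have key : ∀ u v : TangentSpace I p,
      mvfderiv I (fun q ↦ mvfderiv I f q (extend E v q)) p u =
        2 * (inner ℝ (cov (fun q ↦ cov (extend E w) q (extend E v q)) p u) w +
          inner ℝ (cov (extend E w) p u) (cov (extend E w) p v)) := by
    intro u v
    have hY := eventually_contMDiffAt_cov_extend hcov.smooth v w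
    have h1 : (fun q ↦ mvfderiv I f q (extend E v q)) =ᶠ[𝓝 p]
        fun q ↦ 2 * inner ℝ (cov (extend E w) q (extend E v q)) (extend E w q) := by
      filter_upwards [hW] with q hq
      rw [hf, hcov.metric _ _ q _ (hq.mdifferentiableAt (by simp)) (hq.mdifferentiableAt (by simp)),
        real_inner_comm (cov (extend E w) q (extend E v q))]
      ring
    have hYd := mdifferentiableAt_of_eventually hY
    have hWd := mdifferentiableAt_of_eventually hW
    rw [mvfderiv_congr h1, mvfderiv_fun_mul mdifferentiableAt_const
      (MDifferentiableAt.inner_bundle (IB := I) (F := E) (E := fun x : M ↦ TangentSpace I x)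
        hYd hWd), mvfderiv_const, smul_zero, add_zero, smul_apply, hcov.metric _ _ p u hYd hWd,
      extend_apply_self, extend_apply_self, real_inner_comm (cov (extend E w) p u), smul_eq_mul]
  have h := mvfderiv_extend_comm hfs u v
  rw [key, key, real_inner_comm (cov (extend E w) p u)] at h
  rw [curvatureTensor_eq, inner_sub_left]
  linarith

lemma IsLeviCivita.isAlgebraicCurvature (hcov : IsLeviCivita cov) (p : M) :
    IsAlgebraicCurvature (V := TangentSpace I p) (curvatureTensor cov) where
  add_left u u' v w := by
    simp only [curvatureTensor_eq, cov_cov_extend_add_left hcov.smooth, map_add,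
      add_apply]
    abel
  add_right u v w w' := by
    simp only [curvatureTensor_eq, cov_cov_extend_add_right hcov.smooth,
      add_apply]
    abel
  swap u v w := by simp only [curvatureTensor_eq]; abel
  inner_self := hcov.inner_curvatureTensor_self
  bianchi u v w := by
    -- Without torsion $\nabla_YZ=\nabla_ZY$ for coordinate fields near `p`; after this exchange the
    -- cyclic sum cancels in pairs.
    have h : ∀ u v w : TangentSpace I p,
        cov (fun q ↦ cov (extend E w) q (extend E v q)) p u =
          cov (fun q ↦ cov (extend E v) q (extend E w q)) p u := fun u v w ↦ by
      rw [cov_congr (mdifferentiableAt_of_eventually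
        (eventually_contMDiffAt_cov_extend hcov.smooth w v)) (hcov.eventually_cov_extend_comm v w)]
    simp only [curvatureTensor_eq]
    rw [h u v w, h v w u, h w u v]
    abel

/-- The curvature tensor of a manifold of constant sectional curvature. -/
lemma IsLeviCivita.curvatureTensor_of_const (hcov : IsLeviCivita cov) {ρ : ℝ}
    (hρ : HasConstantSectionalCurvature cov ρ) {p : M} (u v w : TangentSpace I p) :
    curvatureTensor cov u v w = ρ • ((inner ℝ v w : ℝ) • u - (inner ℝ u w : ℝ) • v) := by
  refine (hcov.isAlgebraicCurvature p).eq_of_sectional (hρ p) (fun a u v w ↦ ?_) u v w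
  simp only [curvatureTensor_eq, cov_cov_extend_smul_left hcov.smooth, map_smul,
    smul_apply, smul_sub]

end Curvature

/-! ### Covariant differentiation of fields along a curve. -/

section Along

variable {E : Type*} [NormedAddCommGroup E] [NormedSpace ℝ E] [FiniteDimensional ℝ E]
  {H : Type*} [TopologicalSpace H] {I : ModelWithCorners ℝ E H} [I.Boundaryless]
  {M : Type*} [TopologicalSpace M] [ChartedSpace H M] [IsManifold I ∞ M] [T2Space M]
  {cov : CovariantDerivative I E (TangentSpace I : M → Type _)}
  {γ : ℝ → M} {V W : ∀ t, TangentSpace I (γ t)} {s : ℝ}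

/-- The coordinates of a field along a curve in the frame of the preferred chart at `γ s`. -/
def coordAlong (γ : ℝ → M) (s : ℝ) (V : ∀ t, TangentSpace I (γ t)) (t : ℝ) : E :=
  (trivializationAt E (TangentSpace I : M → Type _) (γ s) ⟨γ t, V t⟩).2

lemma coordAlong_eq {t : ℝ}
    (ht : γ t ∈ (trivializationAt E (TangentSpace I : M → Type _) (γ s)).baseSet) :
    coordAlong γ s V t =
      (trivializationAt E (TangentSpace I : M → Type _) (γ s)).continuousLinearMapAt ℝ (γ t)
        (V t) :=
  (Trivialization.continuousLinearMapAt_apply_of_mem ℝ _ ht _).symm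

lemma eventually_mem_baseSet_comp (hγ : ContinuousAt γ s) :
    ∀ᶠ t in 𝓝 s, γ t ∈ (trivializationAt E (TangentSpace I : M → Type _) (γ s)).baseSet :=
  hγ.eventually (eventually_mem_baseSet (γ s))

lemma coordAlong_add (hγ : ContinuousAt γ s) :
    coordAlong γ s (V + W) =ᶠ[𝓝 s] coordAlong γ s V + coordAlong γ s W := by
  filter_upwards [eventually_mem_baseSet_comp (I := I) hγ] with t ht
  simp [coordAlong_eq ht]

lemma coordAlong_smul (hγ : ContinuousAt γ s) (f : ℝ → ℝ) :
    coordAlong γ s (fun t ↦ f t • V t) =ᶠ[𝓝 s] f • coordAlong γ s V := by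
  filter_upwards [eventually_mem_baseSet_comp (I := I) hγ] with t ht
  simp [coordAlong_eq ht]

lemma coordAlong_extend (hγ : ContinuousAt γ s) (w : TangentSpace I (γ s)) :
    coordAlong γ s (fun t ↦ extend E w (γ t)) =ᶠ[𝓝 s] fun _ ↦
      (trivializationAt E (TangentSpace I : M → Type _) (γ s)).continuousLinearMapAt ℝ (γ s) w := by
  filter_upwards [eventually_mem_baseSet_comp (I := I) hγ] with t ht
  rw [coordAlong_eq ht, extend_eq_symmL _ ht]
  exact Trivialization.continuousLinearMapAt_symmL _ ht _

lemma coordAlong_congr (h : ∀ᶠ t in 𝓝 s, V t = W t) :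
    coordAlong γ s V =ᶠ[𝓝 s] coordAlong γ s W := by
  filter_upwards [h] with t ht
  simp only [coordAlong, ht]

variable (γ V s) in
/-- The field `V` along `γ` is differentiable at `s`. -/
def DifferentiableAlong : Prop :=
  MDifferentiableAt 𝓘(ℝ, ℝ) I.tangent (fun t ↦ (⟨γ t, V t⟩ : TangentBundle I M)) s

lemma differentiableAlong_iff : DifferentiableAlong γ V s ↔
    MDifferentiableAt 𝓘(ℝ, ℝ) I γ s ∧ DifferentiableAt ℝ (coordAlong γ s V) s := by
  rw [DifferentiableAlong, mdifferentiableAt_totalSpace, mdifferentiableAt_iff_differentiableAt]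
  rfl

lemma DifferentiableAlong.add (hV : DifferentiableAlong γ V s) (hW : DifferentiableAlong γ W s) :
    DifferentiableAlong γ (V + W) s := by
  rw [differentiableAlong_iff] at hV hW ⊢
  exact ⟨hV.1, (hV.2.add hW.2).congr_of_eventuallyEq (coordAlong_add hV.1.continuousAt)⟩

lemma DifferentiableAlong.smul {f : ℝ → ℝ} (hf : DifferentiableAt ℝ f s)
    (hV : DifferentiableAlong γ V s) : DifferentiableAlong γ (fun t ↦ f t • V t) s := by
  rw [differentiableAlong_iff] at hV ⊢
  exact ⟨hV.1, (hf.smul hV.2).congr_of_eventuallyEq (coordAlong_smul hV.1.continuousAt f)⟩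

lemma differentiableAlong_comp (hγ : MDifferentiableAt 𝓘(ℝ, ℝ) I γ s)
    {σ : ∀ q : M, TangentSpace I q}
    (hσ : MDifferentiableAt I I.tangent (fun q ↦ (⟨q, σ q⟩ : TangentBundle I M)) (γ s)) :
    DifferentiableAlong γ (fun t ↦ σ (γ t)) s :=
  hσ.comp s hγ

lemma covDerivAlong_eq : covDerivAlong cov γ V s =
    (trivializationAt E (TangentSpace I : M → Type _) (γ s)).symmL ℝ (γ s)
      (deriv (coordAlong γ s V) s) + cov (extend E (V s)) (γ s) (velocity I γ s) := rfl

lemma covDerivAlong_congr (h : ∀ᶠ t in 𝓝 s, V t = W t) :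
    covDerivAlong cov γ V s = covDerivAlong cov γ W s := by
  rw [covDerivAlong_eq, covDerivAlong_eq, (coordAlong_congr h).deriv_eq, h.self_of_nhds]

lemma cov_extend_add {p : M} (u v : TangentSpace I p) :
    cov (extend E (u + v)) p = cov (extend E u) p + cov (extend E v) p := by
  have hu := mdifferentiableAt_extend I E u
  have hv := mdifferentiableAt_extend I E v
  rw [← cov.isCovariantDerivativeOnUniv.add hu hv]
  exact cov_congr (mdifferentiableAt_add_section hu hv) (eventually_extend_add u v)

lemma cov_extend_smul {p : M} (a : ℝ) (u : TangentSpace I p) :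
    cov (extend E (a • u)) p = a • cov (extend E u) p := by
  have hu := mdifferentiableAt_extend I E u
  rw [← cov.isCovariantDerivativeOnUniv.smul_const a hu]
  exact cov_congr (mdifferentiableAt_const.smul_section hu) (eventually_extend_smul a u)

lemma covDerivAlong_add (hV : DifferentiableAlong γ V s) (hW : DifferentiableAlong γ W s) :
    covDerivAlong cov γ (V + W) s = covDerivAlong cov γ V s + covDerivAlong cov γ W s := by
  rw [differentiableAlong_iff] at hV hW
  rw [covDerivAlong_eq, (coordAlong_add hV.1.continuousAt).deriv_eq, deriv_add hV.2 hW.2,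
    Pi.add_apply, cov_extend_add, covDerivAlong_eq, covDerivAlong_eq, map_add, add_apply]
  abel

lemma covDerivAlong_smul {f : ℝ → ℝ} (hf : DifferentiableAt ℝ f s)
    (hV : DifferentiableAlong γ V s) :
    covDerivAlong cov γ (fun t ↦ f t • V t) s =
      deriv f s • V s + f s • covDerivAlong cov γ V s := by
  rw [differentiableAlong_iff] at hV
  have h : (trivializationAt E (TangentSpace I : M → Type _) (γ s)).symmL ℝ (γ s)
      (coordAlong γ s V s) = V s := by
    have hs := mem_baseSet_trivializationAt E (TangentSpace I : M → Type _) (γ s)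
    rw [coordAlong_eq hs, Trivialization.symmL_continuousLinearMapAt _ hs]
  rw [covDerivAlong_eq, (coordAlong_smul hV.1.continuousAt f).deriv_eq, deriv_smul hf hV.2,
    cov_extend_smul, covDerivAlong_eq, map_add, map_smul, map_smul, h, smul_apply, smul_add]
  abel

lemma velocity_apply_mvfderiv {f : M → ℝ} (hf : MDifferentiableAt I 𝓘(ℝ, ℝ) f (γ s))
    (hγ : MDifferentiableAt 𝓘(ℝ, ℝ) I γ s) :
    HasDerivAt (fun t ↦ f (γ t)) (mvfderiv I f (γ s) (velocity I γ s)) s := by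
  have h : HasFDerivAt (f ∘ γ) (_ : ℝ →L[ℝ] ℝ) s :=
    (hf.hasMFDerivAt.comp s hγ.hasMFDerivAt).hasFDerivAt
  exact h.hasDerivAt

/-- The covariant derivative of the restriction to a curve of a vector field. -/
lemma covDerivAlong_comp (hγ : MDifferentiableAt 𝓘(ℝ, ℝ) I γ s)
    {σ : ∀ q : M, TangentSpace I q}
    (hσ : MDifferentiableAt I I.tangent (fun q ↦ (⟨q, σ q⟩ : TangentBundle I M)) (γ s)) :
    covDerivAlong cov γ (fun t ↦ σ (γ t)) s = cov σ (γ s) (velocity I γ s) := by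
  set Φ : (∀ q : M, TangentSpace I q) → TangentSpace I (γ s) := fun σ ↦
    covDerivAlong cov γ (fun t ↦ σ (γ t)) s - cov σ (γ s) (velocity I γ s) with hΦ
  have ht : TensorialAt I E Φ (γ s) :=
    -- The derivative terms of the two Leibniz rules agree by the chain rule, so the difference `Φ`
    -- is tensorial and may be evaluated on the coordinate extension, where it is zero.
    { smul := fun {f σ} hf hσ ↦ by
        have h1 := velocity_apply_mvfderiv hf hγ
        have h2 := covDerivAlong_smul (cov := cov) h1.differentiableAt
          (differentiableAlong_comp hγ hσ)
        rw [h1.deriv] at h2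
        simp only [hΦ]
        rw [cov.isCovariantDerivativeOnUniv.leibniz hσ hf, add_apply, smul_apply]
        refine (congrArg (· - _) h2).trans ?_
        rw [ContinuousLinearMap.smulRight_apply, smul_sub]
        abel
      add := fun {σ σ'} hσ hσ' ↦ by
        simp only [hΦ]
        rw [cov.isCovariantDerivativeOnUniv.add hσ hσ', add_apply]
        refine (congrArg (· - _) (covDerivAlong_add (differentiableAlong_comp hγ hσ)
          (differentiableAlong_comp hγ hσ'))).trans ?_
        abel }
  have h0 : Φ (extend E (σ (γ s))) = 0 := by
    simp only [hΦ]
    rw [covDerivAlong_eq, (coordAlong_extend hγ.continuousAt _).deriv_eq, deriv_const, map_zero,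
      extend_apply_self, zero_add, sub_self]
  have h1 := ht.pointwise hσ (mdifferentiableAt_extend I E (σ (γ s))) (by simp)
  exact sub_eq_zero.1 (h1.trans h0)

variable (γ V s) in
/-- The field `V` along `γ` is smooth near `s`. -/
def SmoothAlong : Prop :=
  ∀ᶠ t in 𝓝 s, ContMDiffAt 𝓘(ℝ, ℝ) I.tangent ∞ (fun t ↦ (⟨γ t, V t⟩ : TangentBundle I M)) t

lemma smoothAlong_iff : SmoothAlong γ V s ↔
    (∀ᶠ t in 𝓝 s, ContMDiffAt 𝓘(ℝ, ℝ) I ∞ γ t) ∧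
      ∀ᶠ t in 𝓝 s, ContDiffAt ℝ ∞ (coordAlong γ s V) t := by
  have key : ∀ t, γ t ∈ (trivializationAt E (TangentSpace I : M → Type _) (γ s)).baseSet →
      (ContMDiffAt 𝓘(ℝ, ℝ) I.tangent ∞ (fun t ↦ (⟨γ t, V t⟩ : TangentBundle I M)) t ↔
        ContMDiffAt 𝓘(ℝ, ℝ) I ∞ γ t ∧ ContDiffAt ℝ ∞ (coordAlong γ s V) t) := by
    intro t ht
    rw [Trivialization.contMDiffAt_iff (e := trivializationAt E (TangentSpace I : M → Type _) (γ s))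
      (by simpa [Trivialization.mem_source] using ht), contMDiffAt_iff_contDiffAt]
    rfl
  constructor
  · intro h
    have hγ : ContinuousAt γ s :=
      (contMDiffAt_totalSpace.1 h.self_of_nhds).1.continuousAt
    rw [← eventually_and]
    filter_upwards [h, eventually_mem_baseSet_comp (I := I) hγ] with t h1 h2
    exact (key t h2).1 h1
  · rintro ⟨h1, h2⟩
    filter_upwards [h1, h2, eventually_mem_baseSet_comp (I := I) h1.self_of_nhds.continuousAt]
      with t h1 h2 h3
    exact (key t h3).2 ⟨h1, h2⟩

lemma SmoothAlong.smooth_curve (h : SmoothAlong γ V s) :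
    ∀ᶠ t in 𝓝 s, ContMDiffAt 𝓘(ℝ, ℝ) I ∞ γ t :=
  (smoothAlong_iff.1 h).1

lemma SmoothAlong.differentiableAlong (h : SmoothAlong γ V s) : DifferentiableAlong γ V s :=
  h.self_of_nhds.mdifferentiableAt (by simp)

lemma eventually_contDiffAt_congr {F : Type*} [NormedAddCommGroup F] [NormedSpace ℝ F]
    {f g : ℝ → F} (hg : ∀ᶠ t in 𝓝 s, ContDiffAt ℝ ∞ g t) (h : f =ᶠ[𝓝 s] g) :
    ∀ᶠ t in 𝓝 s, ContDiffAt ℝ ∞ f t := by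
  filter_upwards [hg, h.eventuallyEq_nhds] with t h1 h2
  exact h1.congr_of_eventuallyEq h2

lemma contDiffAt_deriv {F : Type*} [NormedAddCommGroup F] [NormedSpace ℝ F] {f : ℝ → F}
    (hf : ContDiffAt ℝ ∞ f s) : ContDiffAt ℝ ∞ (deriv f) s := by
  have h := (hf.fderiv_right (m := ∞) (by simp)).clm_apply (contDiffAt_const (c := (1 : ℝ)))
  simpa only [fderiv_apply_one_eq_deriv] using h

lemma SmoothAlong.congr (hV : SmoothAlong γ V s) (h : ∀ᶠ t in 𝓝 s, W t = V t) :
    SmoothAlong γ W s := by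
  rw [smoothAlong_iff] at hV ⊢
  exact ⟨hV.1, eventually_contDiffAt_congr hV.2 (coordAlong_congr h)⟩

lemma SmoothAlong.add (hV : SmoothAlong γ V s) (hW : SmoothAlong γ W s) :
    SmoothAlong γ (V + W) s := by
  rw [smoothAlong_iff] at hV hW ⊢
  exact ⟨hV.1, eventually_contDiffAt_congr (hV.2.mp (hW.2.mono fun t h1 h2 ↦ h2.add h1))
    (coordAlong_add hV.1.self_of_nhds.continuousAt)⟩

lemma SmoothAlong.smul {f : ℝ → ℝ} (hf : ∀ᶠ t in 𝓝 s, ContDiffAt ℝ ∞ f t)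
    (hV : SmoothAlong γ V s) : SmoothAlong γ (fun t ↦ f t • V t) s := by
  rw [smoothAlong_iff] at hV ⊢
  exact ⟨hV.1, eventually_contDiffAt_congr (hf.mp (hV.2.mono fun t h1 h2 ↦ h2.smul h1))
    (coordAlong_smul hV.1.self_of_nhds.continuousAt f)⟩

lemma smoothAlong_extend (hγ : ∀ᶠ t in 𝓝 s, ContMDiffAt 𝓘(ℝ, ℝ) I ∞ γ t)
    (w : TangentSpace I (γ s)) : SmoothAlong γ (fun t ↦ extend E w (γ t)) s := by
  rw [smoothAlong_iff]
  exact ⟨hγ, eventually_contDiffAt_congr (Eventually.of_forall fun _ ↦ contDiffAt_const)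
    (coordAlong_extend hγ.self_of_nhds.continuousAt w)⟩

/-- A property of smooth fields along a curve that is local and additive holds for all of them, if
it holds for multiples of coordinate fields. -/
lemma SmoothAlong.induction {P : (∀ t, TangentSpace I (γ t)) → Prop}
    (hsmul : ∀ (f : ℝ → ℝ) (w : TangentSpace I (γ s)), (∀ᶠ t in 𝓝 s, ContDiffAt ℝ ∞ f t) →
      P fun t ↦ f t • extend E w (γ t))
    (hadd : ∀ V W, SmoothAlong γ V s → SmoothAlong γ W s → P V → P W → P (V + W))
    (hcongr : ∀ V W, (∀ᶠ t in 𝓝 s, W t = V t) → P V → P W) (hV : SmoothAlong γ V s) : P V := by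
  have hV' := smoothAlong_iff.1 hV
  set e := trivializationAt E (TangentSpace I : M → Type _) (γ s)
  let b := Module.finBasis ℝ E
  let w : Fin (Module.finrank ℝ E) → TangentSpace I (γ s) := fun i ↦ e.symmL ℝ (γ s) (b i)
  let f : Fin (Module.finrank ℝ E) → ℝ → ℝ := fun i t ↦ b.coord i (coordAlong γ s V t)
  have hf : ∀ i, ∀ᶠ t in 𝓝 s, ContDiffAt ℝ ∞ (f i) t := fun i ↦ hV'.2.mono fun t ht ↦
    (LinearMap.toContinuousLinearMap (b.coord i)).contDiff.contDiffAt.comp t ht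
  have hsum : ∀ S : Finset (Fin (Module.finrank ℝ E)),
      SmoothAlong γ (fun t ↦ ∑ i ∈ S, f i t • extend E (w i) (γ t)) s ∧
        P (fun t ↦ ∑ i ∈ S, f i t • extend E (w i) (γ t)) := by
    intro S
    induction S using Finset.induction_on with
    | empty =>
      -- The empty sum is presented as a multiple of a coordinate field so that `hsmul` covers it.
      have hz : ∀ t, ∑ i ∈ ∅, f i t • extend E (w i) (γ t) =
          (0 : ℝ) • (extend E (0 : TangentSpace I (γ s)) (γ t) : TangentSpace I (γ t)) := by simp
      simp only [hz]
      have h0 : ∀ᶠ t in 𝓝 s, ContDiffAt ℝ ∞ (fun _ : ℝ ↦ (0 : ℝ)) t :=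
        Eventually.of_forall fun _ ↦ contDiffAt_const
      exact ⟨(smoothAlong_extend hV'.1 0).smul h0, hsmul _ 0 h0⟩
    | insert i S hi ih =>
      simp only [Finset.sum_insert hi]
      have h1 := (smoothAlong_extend hV'.1 (w i)).smul (hf i)
      exact ⟨h1.add ih.1, hadd _ _ h1 ih.1 (hsmul _ _ (hf i)) ih.2⟩
  refine hcongr _ _ ?_ (hsum Finset.univ).2
  filter_upwards [eventually_mem_baseSet_comp (I := I) hV'.1.self_of_nhds.continuousAt] with t ht
  have hs := mem_baseSet_trivializationAt E (TangentSpace I : M → Type _) (γ s)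
  have h1 : ∀ i, (extend E (w i) (γ t) : TangentSpace I (γ t)) = e.symmL ℝ (γ t) (b i) := by
    intro i
    rw [extend_eq_symmL _ ht]
    congr 1
    exact Trivialization.continuousLinearMapAt_symmL _ hs _
  simp only [h1, ← map_smul, ← map_sum, f, Module.Basis.coord_apply]
  rw [b.sum_repr, coordAlong_eq ht]
  exact (Trivialization.symmL_continuousLinearMapAt _ ht _).symm

lemma smoothAlong_velocity (hγ : ∀ᶠ t in 𝓝 s, ContMDiffAt 𝓘(ℝ, ℝ) I ∞ γ t) :
    SmoothAlong γ (velocity I γ) s := by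
  rw [smoothAlong_iff]
  refine ⟨hγ, ?_⟩
  have hsrc : ∀ᶠ t in 𝓝 s, γ t ∈ (chartAt H (γ s)).source :=
    hγ.self_of_nhds.continuousAt.eventually
      ((chartAt H (γ s)).open_source.mem_nhds (mem_chart_source H (γ s)))
  have hφ : ∀ᶠ t in 𝓝 s, ContDiffAt ℝ ∞ (fun t ↦ extChartAt I (γ s) (γ t)) t := by
    filter_upwards [hγ, hsrc] with t h1 h2
    exact contMDiffAt_iff_contDiffAt.1 ((contMDiffAt_extChartAt' h2).comp t h1)
  refine eventually_contDiffAt_congr (g := deriv fun t ↦ extChartAt I (γ s) (γ t)) ?_ ?_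
  · exact hφ.mono fun t ht ↦ contDiffAt_deriv ht
  · filter_upwards [hγ, hsrc] with t h1 h2
    have h3 : HasFDerivAt (extChartAt I (γ s) ∘ γ) (_ : ℝ →L[ℝ] E) t :=
      ((mdifferentiableAt_extChartAt (I := I) h2).hasMFDerivAt.comp t
        (h1.mdifferentiableAt (by simp)).hasMFDerivAt).hasFDerivAt
    rw [coordAlong_eq (by simpa using h2),
      TangentBundle.continuousLinearMapAt_trivializationAt h2]
    exact h3.hasDerivAt.deriv.symm

/-- The covariant derivative of a smooth field along a curve is smooth. -/
lemma SmoothAlong.covDerivAlong (hcov : CovariantDerivative.ContMDiffCovariantDerivative cov ∞)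
    (hV : SmoothAlong γ V s) : SmoothAlong γ (covDerivAlong cov γ V) s := by
  have hγ := hV.smooth_curve
  -- `covDerivAlong` at `t` uses the chart at `γ t`, which varies with `t`, so smoothness cannot be
  -- read off its formula. On `f • extend E w` the Leibniz rule and `covDerivAlong_comp` give an
  -- expression not tied to those charts.
  refine SmoothAlong.induction
    (P := fun V ↦ SmoothAlong γ (TriharmonicCurves.covDerivAlong cov γ V) s)
    ?_ ?_ ?_ hV
  · intro f w hf
    have hw := smoothAlong_extend hγ w
    have hcw : SmoothAlong γ (fun t ↦ cov (extend E w) (γ t) (velocity I γ t)) s := by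
      filter_upwards [hγ, smoothAlong_velocity hγ, hγ.self_of_nhds.continuousAt.eventually
        (eventually_eventually_nhds.2 (eventually_contMDiffAt_extend w))] with t h1 h2 h3
      exact ContMDiffAt.clm_bundle_apply (E₁ := (TangentSpace I : M → Type _))
        (E₂ := (TangentSpace I : M → Type _)) ((contMDiffAt_cov hcov h3).comp t h1) h2
    have hf' : ∀ᶠ t in 𝓝 s, ContDiffAt ℝ ∞ (deriv f) t :=
      hf.mono fun t ht ↦ contDiffAt_deriv ht
    refine SmoothAlong.congr ((hw.smul hf').add (hcw.smul hf)) ?_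
    filter_upwards [hf, hw, hγ, hγ.self_of_nhds.continuousAt.eventually
        (eventually_contMDiffAt_extend w)] with t h1 h2 h3 h4
    rw [covDerivAlong_smul (h1.differentiableAt (by simp)) (h2.mdifferentiableAt (by simp)),
      covDerivAlong_comp (h3.mdifferentiableAt (by simp)) (h4.mdifferentiableAt (by simp))]
    rfl
  · intro V W hV hW h1 h2
    refine (h1.add h2).congr ?_
    filter_upwards [hV, hW] with t hVt hWt
    exact covDerivAlong_add (hVt.mdifferentiableAt (by simp)) (hWt.mdifferentiableAt (by simp))
  · intro V W h h1
    refine h1.congr ?_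
    filter_upwards [eventually_eventually_nhds.2 h] with t ht
    exact covDerivAlong_congr ht

variable [RiemannianBundle (fun x : M ↦ TangentSpace I x)]
  [IsContMDiffRiemannianBundle I ∞ E (fun x : M ↦ TangentSpace I x)]

lemma SmoothAlong.inner (hV : SmoothAlong γ V s) (hW : SmoothAlong γ W s) :
    ∀ᶠ t in 𝓝 s, ContDiffAt ℝ ∞ (fun t ↦ (inner ℝ (V t) (W t) : ℝ)) t := by
  filter_upwards [hV, hW] with t h1 h2
  exact contMDiffAt_iff_contDiffAt.1 (ContMDiffAt.inner_bundle (IB := I) (F := E)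
    (E := fun x : M ↦ TangentSpace I x) h1 h2)

/-- Compatibility of the covariant derivative along a curve with the metric. -/
lemma IsLeviCivita.hasDerivAt_inner (hcov : IsLeviCivita cov) (hV : SmoothAlong γ V s)
    (hW : SmoothAlong γ W s) :
    HasDerivAt (fun t ↦ (inner ℝ (V t) (W t) : ℝ))
      (inner ℝ (covDerivAlong cov γ V s) (W s) + inner ℝ (V s) (covDerivAlong cov γ W s)) s := by
  have hγ := hV.smooth_curve
  have hγs := hγ.self_of_nhds.mdifferentiableAt (by simp)
  -- Reduces the first argument to coordinate fields. Applied twice, with `comm` exchanging the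
  -- arguments, it leaves two coordinate fields, where compatibility on `M` applies.
  have key : ∀ W, SmoothAlong γ W s → (∀ w : TangentSpace I (γ s),
      HasDerivAt (fun t ↦ (inner ℝ (extend E w (γ t) : TangentSpace I (γ t)) (W t) : ℝ))
        (inner ℝ (covDerivAlong cov γ (fun t ↦ extend E w (γ t)) s) (W s) +
          inner ℝ (extend E w (γ s)) (covDerivAlong cov γ W s)) s) →
      ∀ V, SmoothAlong γ V s → HasDerivAt (fun t ↦ (inner ℝ (V t) (W t) : ℝ))
        (inner ℝ (covDerivAlong cov γ V s) (W s)
          + inner ℝ (V s) (covDerivAlong cov γ W s)) s := by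
    intro W hW hw V hV
    refine SmoothAlong.induction (P := fun V ↦ HasDerivAt (fun t ↦ (inner ℝ (V t) (W t) : ℝ))
        (inner ℝ (covDerivAlong cov γ V s) (W s)
          + inner ℝ (V s) (covDerivAlong cov γ W s)) s) ?_ ?_ ?_ hV
    · intro f w hf
      have hfs := hf.self_of_nhds.differentiableAt (by simp)
      have h := hfs.hasDerivAt.mul (hw w)
      rw [covDerivAlong_smul hfs (smoothAlong_extend hγ w).differentiableAlong]
      simp only [inner_smul_left, inner_add_left, conj_trivial]
      exact h.congr_deriv (by ring)
    · intro V V' hV hV' h h'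
      rw [covDerivAlong_add hV.differentiableAlong hV'.differentiableAlong]
      simp only [Pi.add_apply, inner_add_left]
      exact (h.add h').congr_deriv (by ring)
    · intro V V' hVV h
      rw [covDerivAlong_congr hVV, hVV.self_of_nhds]
      refine h.congr_of_eventuallyEq ?_
      filter_upwards [hVV] with t ht
      rw [ht]
  have comm : ∀ V W : ∀ t, TangentSpace I (γ t), HasDerivAt (fun t ↦ (inner ℝ (V t) (W t) : ℝ))
      (inner ℝ (covDerivAlong cov γ V s) (W s) + inner ℝ (V s) (covDerivAlong cov γ W s)) s →
      HasDerivAt (fun t ↦ (inner ℝ (W t) (V t) : ℝ))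
      (inner ℝ (covDerivAlong cov γ W s) (V s) + inner ℝ (W s) (covDerivAlong cov γ V s)) s := by
    intro V W h
    rw [add_comm, real_inner_comm (W s), real_inner_comm (covDerivAlong cov γ W s)] at h
    simpa only [real_inner_comm] using h
  refine key W hW (fun w ↦ comm _ _ (key _ (smoothAlong_extend hγ w) (fun w' ↦ ?_) W hW)) V hV
  have hw := mdifferentiableAt_extend I E w
  have hw' := mdifferentiableAt_extend I E w'
  rw [covDerivAlong_comp hγs hw, covDerivAlong_comp hγs hw', ← hcov.metric _ _ _ _ hw' hw]
  exact velocity_apply_mvfderiv (MDifferentiableAt.inner_bundle (IB := I) (F := E)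
    (E := fun x : M ↦ TangentSpace I x) hw' hw) hγs

end Along

/-! ### The overdetermined system for the curvature when the torsion is constant. -/

section ODE

/-- A preconnected image inside a totally disconnected set has at most one point. -/
lemma eq_of_continuousOn_of_finite {S : Set ℝ} (hS : IsPreconnected S) {f : ℝ → ℝ}
    (hf : ContinuousOn f S) {A : Set ℝ} (hA : A.Finite) (h : ∀ s ∈ S, f s ∈ A) :
    ∀ x ∈ S, ∀ y ∈ S, f x = f y := fun _ hx _ hy ↦
  hA.countable.isTotallyDisconnected (f '' S) (image_subset_iff.2 h) (hS.image f hf)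
    (mem_image_of_mem f hx) (mem_image_of_mem f hy)

lemma eq_of_hasDerivAt_zero {S : Set ℝ} (hSo : IsOpen S) (hS : IsPreconnected S) {f : ℝ → ℝ}
    (hf : ∀ s ∈ S, HasDerivAt f 0 s) : ∀ x ∈ S, ∀ y ∈ S, f x = f y := fun _ hx _ hy ↦
  hSo.is_const_of_deriv_eq_zero hS (fun s hs ↦ (hf s hs).differentiableAt.differentiableWithinAt)
    (fun s hs ↦ (hf s hs).deriv) hx hy

/-- The overdetermined system satisfied by the curvature of a triharmonic curve of constant
torsion has only constant solutions. -/
lemma curvature_ode_const {S : Set ℝ} (hSo : IsOpen S) (hS : IsPreconnected S) {τ ρ : ℝ}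
    {k k₁ k₂ k₃ k₄ : ℝ → ℝ} (h₀ : ∀ s ∈ S, HasDerivAt k (k₁ s) s)
    (h₁ : ∀ s ∈ S, HasDerivAt k₁ (k₂ s) s) (h₂ : ∀ s ∈ S, HasDerivAt k₂ (k₃ s) s)
    (h₃ : ∀ s ∈ S, HasDerivAt k₃ (k₄ s) s)
    (hT : ∀ s ∈ S, 2 * (k₁ s * k₂ s) + k s * k₃ s - 2 * (k s ^ 3 * k₁ s)
      - τ ^ 2 * (k s * k₁ s) = 0)
    (hN : ∀ s ∈ S, k₄ s - 15 * k s * k₁ s ^ 2 - 10 * k s ^ 2 * k₂ s - 6 * τ ^ 2 * k₂ s + k s ^ 5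
      + 2 * τ ^ 2 * k s ^ 3 + τ ^ 4 * k s + ρ * k₂ s - 2 * ρ * k s ^ 3 - ρ * τ ^ 2 * k s = 0) :
    ∀ x ∈ S, ∀ y ∈ S, k x = k y := by
  intro x hx
  -- First integral: the left side of `hT` is an exact derivative.
  set C := k x * k₂ x + k₁ x ^ 2 / 2 - k x ^ 4 / 2 - τ ^ 2 * k x ^ 2 / 2 with hC
  have hC' : ∀ s ∈ S, k s * k₂ s + k₁ s ^ 2 / 2 - k s ^ 4 / 2 - τ ^ 2 * k s ^ 2 / 2 = C := by
    intro s hs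
    refine eq_of_hasDerivAt_zero hSo hS (f := fun s ↦ k s * k₂ s + k₁ s ^ 2 / 2 - k s ^ 4 / 2
      - τ ^ 2 * k s ^ 2 / 2) (fun r hr ↦ ?_) s hs x hx
    refine (((((h₀ r hr).mul (h₂ r hr)).add (((h₁ r hr).pow 2).div_const 2)).sub
      (((h₀ r hr).pow 4).div_const 2)).sub
      ((((h₀ r hr).pow 2).const_mul (τ ^ 2)).div_const 2)).congr_deriv ?_
    linear_combination hT r hr
  -- Second integral: the first one becomes exact after multiplication by `2 * k₁`.
  set D := k x * k₁ x ^ 2 - k x ^ 5 / 5 - τ ^ 2 * k x ^ 3 / 3 - 2 * C * k x with hD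
  have hD' : ∀ s ∈ S, k s * k₁ s ^ 2 - k s ^ 5 / 5 - τ ^ 2 * k s ^ 3 / 3 - 2 * C * k s = D := by
    intro s hs
    refine eq_of_hasDerivAt_zero hSo hS (f := fun s ↦ k s * k₁ s ^ 2 - k s ^ 5 / 5
      - τ ^ 2 * k s ^ 3 / 3 - 2 * C * k s) (fun r hr ↦ ?_) s hs x hx
    refine (((((h₀ r hr).mul ((h₁ r hr).pow 2)).sub (((h₀ r hr).pow 5).div_const 5)).sub
      ((((h₀ r hr).pow 3).const_mul (τ ^ 2)).div_const 3)).sub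
      ((h₀ r hr).const_mul (2 * C))).congr_deriv ?_
    simp only [Pi.pow_apply]
    linear_combination 2 * k₁ r * hC' r hr
  -- Derivative of `hT`, solved for the fourth-order term.
  have h4 : ∀ s ∈ S, k s * k₄ s = -2 * k₂ s ^ 2 - 3 * k₁ s * k₃ s + 6 * k s ^ 2 * k₁ s ^ 2
      + 2 * k s ^ 3 * k₂ s + τ ^ 2 * (k₁ s ^ 2 + k s * k₂ s) := by
    intro s hs
    have hd := ((((((h₁ s hs).mul (h₂ s hs)).const_mul 2).add ((h₀ s hs).mul (h₃ s hs))).sub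
      ((((h₀ s hs).pow 3).mul (h₁ s hs)).const_mul 2)).sub
      (((h₀ s hs).mul (h₁ s hs)).const_mul (τ ^ 2)))
    have hz := hd.unique ((hasDerivAt_const s (0 : ℝ)).congr_of_eventuallyEq
      (Filter.eventually_of_mem (hSo.mem_nhds hs) hT))
    simp only [Pi.pow_apply] at hz
    linear_combination hz
  -- By the two integrals, `p` and `q` at `k` are `k * k₁ ^ 2` and `k ^ 2 * k₂`. `F` is `k ^ 5`
  -- times the normal equation, with `k₄` removed by `h4` and `k₃` by `hT`; no division by `k`
  -- occurs.
  let p : Polynomial ℝ := .C (1 / 5) * .X ^ 5 + .C (τ ^ 2 / 3) * .X ^ 3 + .C (2 * C) * .X + .C D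
  let q : Polynomial ℝ := .C (2 / 5) * .X ^ 5 + .C (τ ^ 2 / 3) * .X ^ 3 - .C (D / 2)
  let F : Polynomial ℝ := -2 * q ^ 2 + 6 * p * q - .C (2 * τ ^ 2) * .X ^ 3 * p
    - 8 * .X ^ 5 * q - .C (5 * τ ^ 2 - ρ) * .X ^ 3 * q - 15 * .X ^ 5 * p + .X ^ 10
    + .C (2 * τ ^ 2 - 2 * ρ) * .X ^ 8 + .C (τ ^ 4 - ρ * τ ^ 2) * .X ^ 6
  have hF : F ≠ 0 := by
    intro h0
    have hc : F.coeff 10 = -126 / 25 := by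
      simp only [F, p, q]
      compute_degree!
    rw [h0] at hc
    norm_num at hc
  refine fun y hy ↦ eq_of_continuousOn_of_finite hS
    (fun s hs ↦ (h₀ s hs).continuousAt.continuousWithinAt) (F.rootSet_finite ℝ)
    (fun s hs ↦ ?_) x hx y hy
  rw [Polynomial.mem_rootSet]
  refine ⟨hF, ?_⟩
  have hp : p.eval (k s) = k s * k₁ s ^ 2 := by
    simp only [p, Polynomial.eval_add, Polynomial.eval_mul, Polynomial.eval_C, Polynomial.eval_pow,
      Polynomial.eval_X]
    linear_combination -hD' s hs
  have hq : q.eval (k s) = k s ^ 2 * k₂ s := by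
    simp only [q, Polynomial.eval_add, Polynomial.eval_sub, Polynomial.eval_mul, Polynomial.eval_C,
      Polynomial.eval_pow, Polynomial.eval_X]
    linear_combination (1 / 2) * hD' s hs - k s * hC' s hs
  rw [Polynomial.coe_aeval_eq_eval]
  simp only [F, Polynomial.eval_add, Polynomial.eval_sub, Polynomial.eval_mul, Polynomial.eval_C,
    Polynomial.eval_pow, Polynomial.eval_X, hp, hq, Polynomial.eval_neg, Polynomial.eval_ofNat]
  linear_combination k s ^ 5 * hN s hs - k s ^ 4 * h4 s hs + 3 * k s ^ 3 * k₁ s * hT s hs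

end ODE

lemma eq_of_orthonormal_three {V : Type*} [NormedAddCommGroup V] [InnerProductSpace ℝ V]
    (hV : Module.finrank ℝ V = 3) {T N B : V} (hT : ‖T‖ = 1) (hN : ‖N‖ = 1) (hB : ‖B‖ = 1)
    (hTN : inner ℝ T N = 0) (hTB : inner ℝ T B = 0) (hNB : inner ℝ N B = 0) (v : V) :
    v = (inner ℝ T v : ℝ) • T + (inner ℝ N v : ℝ) • N + (inner ℝ B v : ℝ) • B := by
  have hon : Orthonormal ℝ ![T, N, B] := by
    rw [orthonormal_iff_ite]
    intro i j
    fin_cases i <;> fin_cases j <;>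
      simp [hT, hN, hB, hTN, hTB, hNB, real_inner_comm T, real_inner_comm N]
  have hspan := hon.linearIndependent.span_eq_top_of_card_eq_finrank (by simp [hV])
  have h := (OrthonormalBasis.mk hon hspan.ge).sum_repr' v
  simpa [Fin.sum_univ_three] using h.symm

/-! ### Frenet frame: regularity and structure equations. -/

section Frenet

variable {E : Type*} [NormedAddCommGroup E] [NormedSpace ℝ E] [FiniteDimensional ℝ E]
  {H : Type*} [TopologicalSpace H] {I : ModelWithCorners ℝ E H} [I.Boundaryless]
  {M : Type*} [TopologicalSpace M] [ChartedSpace H M] [IsManifold I ∞ M] [T2Space M]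
  [RiemannianBundle (fun x : M ↦ TangentSpace I x)]
  [IsContMDiffRiemannianBundle I ∞ E (fun x : M ↦ TangentSpace I x)]
  {cov : CovariantDerivative I E (TangentSpace I : M → Type _)} {J : Set ℝ} {γ : ℝ → M}
  {B : ∀ t, TangentSpace I (γ t)} {s : ℝ}

lemma iterCov_succ (k : ℕ) : iterCov cov γ (k + 1) = covDerivAlong cov γ (iterCov cov γ k) := by
  simp only [iterCov, Function.iterate_succ_apply']

lemma IsTriharmonicCurve.eventually_contMDiffAt (hγ : IsTriharmonicCurve cov J γ) (hJ : IsOpen J)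
    (hs : s ∈ J) : ∀ᶠ t in 𝓝 s, ContMDiffAt 𝓘(ℝ, ℝ) I ∞ γ t := by
  filter_upwards [hJ.mem_nhds hs] with t ht
  exact hγ.smooth.contMDiffAt (hJ.mem_nhds ht)

lemma IsTriharmonicCurve.smoothAlong_iterCov (hγ : IsTriharmonicCurve cov J γ)
    (hcov : IsLeviCivita cov) (hJ : IsOpen J) (hs : s ∈ J) (k : ℕ) :
    SmoothAlong γ (iterCov cov γ k) s := by
  induction k with
  | zero => exact smoothAlong_velocity (hγ.eventually_contMDiffAt hJ hs)
  | succ k ih =>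
    rw [iterCov_succ]
    exact ih.covDerivAlong hcov.smooth

lemma curvature_eq_sqrt :
    curvature cov γ = fun t ↦ √(inner ℝ (iterCov cov γ 1 t) (iterCov cov γ 1 t) : ℝ) := by
  funext t
  exact norm_eq_sqrt_real_inner _

/-- Continuity is asserted on all of `J`, zeros of the curvature included, where the norm need not
be smooth; the final connectedness argument relies on this. -/
lemma IsTriharmonicCurve.continuousAt_curvature (hγ : IsTriharmonicCurve cov J γ)
    (hcov : IsLeviCivita cov) (hJ : IsOpen J) (hs : s ∈ J) :
    ContinuousAt (curvature cov γ) s := by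
  have h := hγ.smoothAlong_iterCov hcov hJ hs 1
  rw [curvature_eq_sqrt]
  exact (h.inner h).self_of_nhds.continuousAt.sqrt

lemma IsTriharmonicCurve.isOpen_frenetSet (hγ : IsTriharmonicCurve cov J γ)
    (hcov : IsLeviCivita cov) (hJ : IsOpen J) : IsOpen (frenetSet cov J γ) := by
  rw [isOpen_iff_mem_nhds]
  intro s hs
  filter_upwards [hJ.mem_nhds hs.1,
    (hγ.continuousAt_curvature hcov hJ hs.1).eventually_ne hs.2] with t h1 h2
  exact ⟨h1, h2⟩

lemma IsTriharmonicCurve.contDiffAt_curvature (hγ : IsTriharmonicCurve cov J γ)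
    (hcov : IsLeviCivita cov) (hJ : IsOpen J) (hs : s ∈ frenetSet cov J γ) :
    ContDiffAt ℝ ∞ (curvature cov γ) s := by
  have h := hγ.smoothAlong_iterCov hcov hJ hs.1 1
  have hne : (inner ℝ (iterCov cov γ 1 s) (iterCov cov γ 1 s) : ℝ) ≠ 0 := by
    rw [real_inner_self_eq_norm_sq]
    exact pow_ne_zero 2 hs.2
  rw [curvature_eq_sqrt]
  exact (h.inner h).self_of_nhds.sqrt hne

lemma IsTriharmonicCurve.smoothAlong_normal (hγ : IsTriharmonicCurve cov J γ)
    (hcov : IsLeviCivita cov) (hJ : IsOpen J) (hs : s ∈ frenetSet cov J γ) :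
    SmoothAlong γ (normal cov γ) s := by
  refine (hγ.smoothAlong_iterCov hcov hJ hs.1 1).smul ?_
  filter_upwards [(hγ.isOpen_frenetSet hcov hJ).mem_nhds hs] with t ht
  exact (hγ.contDiffAt_curvature hcov hJ ht).inv ht.2

lemma IsBinormal.smoothAlong (hB : IsBinormal cov J γ B) (hF : IsOpen (frenetSet cov J γ))
    (hs : s ∈ frenetSet cov J γ) : SmoothAlong γ B s := by
  filter_upwards [hF.mem_nhds hs] with t ht
  exact hB.smooth.contMDiffAt (hF.mem_nhds ht)

lemma IsTriharmonicCurve.contDiffAt_torsion (hγ : IsTriharmonicCurve cov J γ)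
    (hcov : IsLeviCivita cov) (hJ : IsOpen J) (hB : IsBinormal cov J γ B)
    (hs : s ∈ frenetSet cov J γ) : ContDiffAt ℝ ∞ (torsion cov γ B) s :=
  (((hγ.smoothAlong_normal hcov hJ hs).covDerivAlong hcov.smooth).inner
    (hB.smoothAlong (hγ.isOpen_frenetSet hcov hJ) hs)).self_of_nhds

lemma curvature_smul_normal (hs : s ∈ frenetSet cov J γ) :
    curvature cov γ s • normal cov γ s = iterCov cov γ 1 s :=
  smul_inv_smul₀ hs.2 _

lemma norm_normal (hs : s ∈ frenetSet cov J γ) : ‖normal cov γ s‖ = 1 := by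
  rw [normal, norm_smul, norm_inv, ← curvature,
    Real.norm_of_nonneg (show 0 ≤ curvature cov γ s from norm_nonneg _)]
  exact inv_mul_cancel₀ hs.2

lemma IsLeviCivita.inner_add_inner_of_const (hcov : IsLeviCivita cov)
    {V W : ∀ t, TangentSpace I (γ t)} (hV : SmoothAlong γ V s) (hW : SmoothAlong γ W s) {c : ℝ}
    (h : ∀ᶠ t in 𝓝 s, (inner ℝ (V t) (W t) : ℝ) = c) :
    (inner ℝ (covDerivAlong cov γ V s) (W s) + inner ℝ (V s) (covDerivAlong cov γ W s) : ℝ) = 0 :=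
  (hcov.hasDerivAt_inner hV hW).unique ((hasDerivAt_const s c).congr_of_eventuallyEq h)

lemma IsTriharmonicCurve.inner_iterCov_one_velocity (hγ : IsTriharmonicCurve cov J γ)
    (hcov : IsLeviCivita cov) (hJ : IsOpen J) (hs : s ∈ J) :
    (inner ℝ (iterCov cov γ 1 s) (velocity I γ s) : ℝ) = 0 := by
  have hT := hγ.smoothAlong_iterCov hcov hJ hs 0
  have h := hcov.inner_add_inner_of_const hT hT (c := 1) (by
    filter_upwards [hJ.mem_nhds hs] with t ht
    rw [real_inner_self_eq_norm_sq]
    exact (congrArg (· ^ 2) (hγ.unitSpeed t ht)).trans (one_pow 2))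
  rw [real_inner_comm (covDerivAlong cov γ (iterCov cov γ 0) s)] at h
  have h2 : (inner ℝ (covDerivAlong cov γ (iterCov cov γ 0) s) (iterCov cov γ 0 s) : ℝ) = 0 := by
    linarith
  rwa [← iterCov_succ] at h2

lemma IsTriharmonicCurve.inner_velocity_normal (hγ : IsTriharmonicCurve cov J γ)
    (hcov : IsLeviCivita cov) (hJ : IsOpen J) (hs : s ∈ J) :
    (inner ℝ (velocity I γ s) (normal cov γ s) : ℝ) = 0 := by
  rw [normal, inner_smul_right, real_inner_comm, hγ.inner_iterCov_one_velocity hcov hJ hs, mul_zero]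

/-- The Frenet equation `∇_T N = -κ T + τ B`. -/
lemma IsTriharmonicCurve.covDerivAlong_normal (hE : Module.finrank ℝ E = 3)
    (hγ : IsTriharmonicCurve cov J γ) (hcov : IsLeviCivita cov) (hJ : IsOpen J)
    (hB : IsBinormal cov J γ B) (hs : s ∈ frenetSet cov J γ) :
    covDerivAlong cov γ (normal cov γ) s =
      -curvature cov γ s • velocity I γ s + torsion cov γ B s • B s := by
  have hFo := (hγ.isOpen_frenetSet hcov hJ).mem_nhds hs
  have hT : SmoothAlong γ (velocity I γ) s := hγ.smoothAlong_iterCov hcov hJ hs.1 0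
  have hN := hγ.smoothAlong_normal hcov hJ hs
  have h1 := hcov.inner_add_inner_of_const hT hN (c := 0) (by
    filter_upwards [hJ.mem_nhds hs.1] with t ht
    exact hγ.inner_velocity_normal hcov hJ ht)
  have h2 := hcov.inner_add_inner_of_const hN hN (c := 1) (by
    filter_upwards [hFo] with t ht
    rw [real_inner_self_eq_norm_sq, norm_normal ht, one_pow])
  have hDT : covDerivAlong cov γ (velocity I γ) s = curvature cov γ s • normal cov γ s := by
    rw [curvature_smul_normal hs]; rfl
  rw [hDT, inner_smul_left, real_inner_self_eq_norm_sq, norm_normal hs] at h1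
  rw [real_inner_comm (normal cov γ s) (covDerivAlong cov γ (normal cov γ) s)] at h2
  have h3 := eq_of_orthonormal_three (V := TangentSpace I (γ s)) hE (hγ.unitSpeed s hs.1)
    (norm_normal hs) (hB.unit s hs) (hγ.inner_velocity_normal hcov hJ hs.1)
    ((real_inner_comm _ _).trans (hB.orthTangent s hs))
    ((real_inner_comm _ _).trans (hB.orthNormal s hs)) (covDerivAlong cov γ (normal cov γ) s)
  have e1 : (inner ℝ (velocity I γ s) (covDerivAlong cov γ (normal cov γ) s) : ℝ) =
      -curvature cov γ s := by
    simp only [conj_trivial] at h1; linarith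
  have e2 : (inner ℝ (normal cov γ s) (covDerivAlong cov γ (normal cov γ) s) : ℝ) = 0 := by
    linarith
  rw [h3, e1, e2, real_inner_comm, zero_smul, add_zero]
  rfl

/-- The Frenet equation `∇_T B = -τ N`. -/
lemma IsTriharmonicCurve.covDerivAlong_binormal (hE : Module.finrank ℝ E = 3)
    (hγ : IsTriharmonicCurve cov J γ) (hcov : IsLeviCivita cov) (hJ : IsOpen J)
    (hB : IsBinormal cov J γ B) (hs : s ∈ frenetSet cov J γ) :
    covDerivAlong cov γ B s = -torsion cov γ B s • normal cov γ s := by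
  have hF := hγ.isOpen_frenetSet hcov hJ
  have hFo := hF.mem_nhds hs
  have hT : SmoothAlong γ (velocity I γ) s := hγ.smoothAlong_iterCov hcov hJ hs.1 0
  have hN := hγ.smoothAlong_normal hcov hJ hs
  have hBs := hB.smoothAlong hF hs
  have h1 := hcov.inner_add_inner_of_const hT hBs (c := 0) (by
    filter_upwards [hFo] with t ht
    rw [real_inner_comm, hB.orthTangent t ht])
  have h2 := hcov.inner_add_inner_of_const hN hBs (c := 0) (by
    filter_upwards [hFo] with t ht
    rw [real_inner_comm, hB.orthNormal t ht])
  have h4 := hcov.inner_add_inner_of_const hBs hBs (c := 1) (by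
    filter_upwards [hFo] with t ht
    rw [real_inner_self_eq_norm_sq, hB.unit t ht, one_pow])
  have hDT : covDerivAlong cov γ (velocity I γ) s = curvature cov γ s • normal cov γ s := by
    rw [curvature_smul_normal hs]; rfl
  rw [hDT, inner_smul_left, real_inner_comm (B s), hB.orthNormal s hs, mul_zero, zero_add] at h1
  have h2' : torsion cov γ B s + inner ℝ (normal cov γ s) (covDerivAlong cov γ B s) = 0 := h2
  rw [real_inner_comm (B s) (covDerivAlong cov γ B s)] at h4
  have h3 := eq_of_orthonormal_three (V := TangentSpace I (γ s)) hE (hγ.unitSpeed s hs.1)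
    (norm_normal hs) (hB.unit s hs) (hγ.inner_velocity_normal hcov hJ hs.1)
    ((real_inner_comm _ _).trans (hB.orthTangent s hs))
    ((real_inner_comm _ _).trans (hB.orthNormal s hs)) (covDerivAlong cov γ B s)
  have e2 : (inner ℝ (normal cov γ s) (covDerivAlong cov γ B s) : ℝ) = -torsion cov γ B s := by
    linarith
  have e3 : (inner ℝ (B s) (covDerivAlong cov γ B s) : ℝ) = 0 := by linarith
  rw [h3, h1, e2, e3, zero_smul, zero_smul, add_zero, zero_add]

/-- The covariant derivative of a field given by its components in the Frenet frame. -/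
lemma IsTriharmonicCurve.covDerivAlong_frame (hE : Module.finrank ℝ E = 3)
    (hγ : IsTriharmonicCurve cov J γ) (hcov : IsLeviCivita cov) (hJ : IsOpen J)
    (hB : IsBinormal cov J γ B) {V : ∀ t, TangentSpace I (γ t)} {a b c : ℝ → ℝ} {a' b' c' : ℝ}
    (hV : ∀ s ∈ frenetSet cov J γ,
      V s = a s • velocity I γ s + b s • normal cov γ s + c s • B s)
    (hs : s ∈ frenetSet cov J γ)
    (ha : HasDerivAt a a' s) (hb : HasDerivAt b b' s) (hc : HasDerivAt c c' s) :
    covDerivAlong cov γ V s = (a' - curvature cov γ s * b s) • velocity I γ s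
      + (b' + curvature cov γ s * a s - torsion cov γ B s * c s) • normal cov γ s
      + (c' + torsion cov γ B s * b s) • B s := by
  have hF := hγ.isOpen_frenetSet hcov hJ
  have hT : SmoothAlong γ (velocity I γ) s := hγ.smoothAlong_iterCov hcov hJ hs.1 0
  have hTd := hT.differentiableAlong
  have hNd := (hγ.smoothAlong_normal hcov hJ hs).differentiableAlong
  have hBd := (hB.smoothAlong hF hs).differentiableAlong
  have hDT : covDerivAlong cov γ (velocity I γ) s = curvature cov γ s • normal cov γ s := by
    rw [curvature_smul_normal hs]; rfl
  rw [covDerivAlong_congr (W := (fun t ↦ a t • velocity I γ t) + (fun t ↦ b t • normal cov γ t)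
      + fun t ↦ c t • B t) (eventually_of_mem (hF.mem_nhds hs) hV),
    covDerivAlong_add ((hTd.smul ha.differentiableAt).add (hNd.smul hb.differentiableAt))
      (hBd.smul hc.differentiableAt),
    covDerivAlong_add (hTd.smul ha.differentiableAt) (hNd.smul hb.differentiableAt),
    covDerivAlong_smul ha.differentiableAt hTd, covDerivAlong_smul hb.differentiableAt hNd,
    covDerivAlong_smul hc.differentiableAt hBd, hDT, hγ.covDerivAlong_normal hE hcov hJ hB hs,
    hγ.covDerivAlong_binormal hE hcov hJ hB hs, ha.deriv, hb.deriv, hc.deriv]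
  module

end Frenet

lemma contDiffAt_iterate_deriv {f : ℝ → ℝ} {s : ℝ} (hf : ContDiffAt ℝ ∞ f s) (i : ℕ) :
    ContDiffAt ℝ ∞ (deriv^[i] f) s := by
  induction i with
  | zero => exact hf
  | succ i ih =>
    rw [Function.iterate_succ_apply']
    exact contDiffAt_deriv ih

lemma hasDerivAt_iterate_deriv {f : ℝ → ℝ} {s : ℝ} (hf : ContDiffAt ℝ ∞ f s) (i : ℕ) :
    HasDerivAt (deriv^[i] f) (deriv^[i + 1] f s) s := by
  rw [Function.iterate_succ_apply']
  exact ((contDiffAt_iterate_deriv hf i).differentiableAt (by simp)).hasDerivAt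

lemma iterate_deriv_eq_zero_of_const {S : Set ℝ} (hS : IsOpen S) {f : ℝ → ℝ} {c : ℝ}
    (hf : ∀ s ∈ S, f s = c) (i : ℕ) : ∀ s ∈ S, deriv^[i + 1] f s = 0 := by
  induction i with
  | zero =>
    intro s hs
    exact (((hasDerivAt_const s c).congr_of_eventuallyEq
      (eventually_of_mem (hS.mem_nhds hs) hf))).deriv
  | succ i ih =>
    intro s hs
    rw [Function.iterate_succ_apply']
    exact (((hasDerivAt_const s (0 : ℝ)).congr_of_eventuallyEq
      (eventually_of_mem (hS.mem_nhds hs) ih))).deriv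

/-! ### The triharmonic equation in the Frenet frame. -/

section Frenet

variable {E : Type*} [NormedAddCommGroup E] [NormedSpace ℝ E] [FiniteDimensional ℝ E]
  {H : Type*} [TopologicalSpace H] {I : ModelWithCorners ℝ E H} [I.Boundaryless]
  {M : Type*} [TopologicalSpace M] [ChartedSpace H M] [IsManifold I ∞ M] [T2Space M]
  [RiemannianBundle (fun x : M ↦ TangentSpace I x)]
  [IsContMDiffRiemannianBundle I ∞ E (fun x : M ↦ TangentSpace I x)]
  {cov : CovariantDerivative I E (TangentSpace I : M → Type _)} {J : Set ℝ} {γ : ℝ → M}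
  {B : ∀ t, TangentSpace I (γ t)} {s : ℝ}

/-- The field along `γ` with components `a`, `b`, `c` in the Frenet frame. -/
def frameField (cov : CovariantDerivative I E (TangentSpace I : M → Type _)) (γ : ℝ → M)
    (B : ∀ t, TangentSpace I (γ t)) (a b c : ℝ → ℝ) (s : ℝ) : TangentSpace I (γ s) :=
  a s • velocity I γ s + b s • normal cov γ s + c s • B s

/-- The tangential and normal components of the triharmonic equation of a curve in a space of
constant curvature. -/
theorem IsTriharmonicCurve.frenet_equations (hE : Module.finrank ℝ E = 3)
    (hγ : IsTriharmonicCurve cov J γ) (hcov : IsLeviCivita cov) {ρ : ℝ}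
    (hρ : HasConstantSectionalCurvature cov ρ) (hJ : IsOpen J) (hB : IsBinormal cov J γ B)
    {k t : ℕ → ℝ → ℝ} (hk : k = fun i ↦ deriv^[i] (curvature cov γ))
    (ht : t = fun i ↦ deriv^[i] (torsion cov γ B)) (hs : s ∈ frenetSet cov J γ) :
    2 * k 1 s * k 2 s + k 0 s * k 3 s - 2 * k 0 s ^ 3 * k 1 s - k 0 s * k 1 s * t 0 s ^ 2
        - k 0 s ^ 2 * t 0 s * t 1 s = 0 ∧
      k 4 s - 15 * k 0 s * k 1 s ^ 2 - 10 * k 0 s ^ 2 * k 2 s - 6 * k 2 s * t 0 s ^ 2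
        - 12 * k 1 s * t 0 s * t 1 s - 3 * k 0 s * t 1 s ^ 2 - 4 * k 0 s * t 0 s * t 2 s
        + k 0 s ^ 5 + 2 * k 0 s ^ 3 * t 0 s ^ 2 + k 0 s * t 0 s ^ 4
        + ρ * (k 2 s - k 0 s ^ 3 - k 0 s * t 0 s ^ 2) - ρ * k 0 s ^ 3 = 0 := by
  have hkd : ∀ i, ∀ s ∈ frenetSet cov J γ, HasDerivAt (k i) (k (i + 1) s) s := fun i s hs ↦ by
    simpa only [hk] using hasDerivAt_iterate_deriv (hγ.contDiffAt_curvature hcov hJ hs) i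
  have htd : ∀ i, ∀ s ∈ frenetSet cov J γ, HasDerivAt (t i) (t (i + 1) s) s := fun i s hs ↦ by
    simpa only [ht] using hasDerivAt_iterate_deriv (hγ.contDiffAt_torsion hcov hJ hB hs) i
  have hk0 : curvature cov γ = k 0 := by rw [hk]; rfl
  have ht0 : torsion cov γ B = t 0 := by rw [ht]; rfl
  have step : ∀ (n : ℕ) (a b c : ℝ → ℝ),
      (∀ s ∈ frenetSet cov J γ, iterCov cov γ n s = frameField cov γ B a b c s) →
      ∀ s ∈ frenetSet cov J γ, ∀ a' b' c' : ℝ,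
      HasDerivAt a a' s → HasDerivAt b b' s → HasDerivAt c c' s →
      iterCov cov γ (n + 1) s = (a' - k 0 s * b s) • velocity I γ s
        + (b' + k 0 s * a s - t 0 s * c s) • normal cov γ s
        + (c' + t 0 s * b s) • B s := fun n a b c h s hs a' b' c' ha hb hc ↦ by
    rw [iterCov_succ, ← hk0, ← ht0]
    exact hγ.covDerivAlong_frame hE hcov hJ hB h hs ha hb hc
  have h1 : ∀ s ∈ frenetSet cov J γ, iterCov cov γ 1 s =
      frameField cov γ B (fun _ ↦ 0) (k 0) (fun _ ↦ 0) s := fun s hs ↦ by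
    simp [frameField, ← curvature_smul_normal hs, hk0]
  have h2 : ∀ s ∈ frenetSet cov J γ, iterCov cov γ 2 s =
      frameField cov γ B (fun s ↦ -k 0 s ^ 2) (k 1) (fun s ↦ k 0 s * t 0 s) s := fun s hs ↦ by
    rw [step 1 _ _ _ h1 s hs _ _ _ (hasDerivAt_const s _) (hkd 0 s hs) (hasDerivAt_const s _),
      frameField]
    module
  have h3 : ∀ s ∈ frenetSet cov J γ, iterCov cov γ 3 s =
      frameField cov γ B (fun s ↦ -3 * (k 0 s * k 1 s))
        (fun s ↦ k 2 s - k 0 s ^ 3 - k 0 s * t 0 s ^ 2)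
        (fun s ↦ 2 * (k 1 s * t 0 s) + k 0 s * t 1 s) s := fun s hs ↦ by
    rw [step 2 _ _ _ h2 s hs _ _ _ ((hkd 0 s hs).pow 2).neg (hkd 1 s hs)
      ((hkd 0 s hs).mul (htd 0 s hs)), frameField]
    push_cast
    module
  have h4 : ∀ s ∈ frenetSet cov J γ, iterCov cov γ 4 s =
      frameField cov γ B
        (fun s ↦ -3 * k 1 s ^ 2 - 4 * (k 0 s * k 2 s) + k 0 s ^ 4 + k 0 s ^ 2 * t 0 s ^ 2)
        (fun s ↦ k 3 s - 6 * (k 0 s ^ 2 * k 1 s) - 3 * (k 1 s * t 0 s ^ 2)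
          - 3 * (k 0 s * (t 0 s * t 1 s)))
        (fun s ↦ 3 * (k 2 s * t 0 s) + 3 * (k 1 s * t 1 s) + k 0 s * t 2 s - k 0 s ^ 3 * t 0 s
          - k 0 s * t 0 s ^ 3) s := fun s hs ↦ by
    rw [step 3 _ _ _ h3 s hs _ _ _ (((hkd 0 s hs).mul (hkd 1 s hs)).const_mul (-3))
      (((hkd 2 s hs).sub ((hkd 0 s hs).pow 3)).sub ((hkd 0 s hs).mul ((htd 0 s hs).pow 2)))
      ((((hkd 1 s hs).mul (htd 0 s hs)).const_mul 2).add ((hkd 0 s hs).mul (htd 1 s hs))),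
      frameField]
    push_cast
    module
  have h5 := step 4 _ _ _ h4 s hs _ _ _
    ((((((hkd 1 s hs).pow 2).const_mul (-3)).sub
      (((hkd 0 s hs).mul (hkd 2 s hs)).const_mul 4)).add ((hkd 0 s hs).pow 4)).add
      (((hkd 0 s hs).pow 2).mul ((htd 0 s hs).pow 2)))
    ((((hkd 3 s hs).sub ((((hkd 0 s hs).pow 2).mul (hkd 1 s hs)).const_mul 6)).sub
      (((hkd 1 s hs).mul ((htd 0 s hs).pow 2)).const_mul 3)).sub
      (((hkd 0 s hs).mul ((htd 0 s hs).mul (htd 1 s hs))).const_mul 3))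
    ((((((hkd 2 s hs).mul (htd 0 s hs)).const_mul 3).add
      (((hkd 1 s hs).mul (htd 1 s hs)).const_mul 3)).add ((hkd 0 s hs).mul (htd 2 s hs))).sub
      (((hkd 0 s hs).pow 3).mul (htd 0 s hs)) |>.sub ((hkd 0 s hs).mul ((htd 0 s hs).pow 3)))
  have hTT : (inner ℝ (velocity I γ s) (velocity I γ s) : ℝ) = 1 := by
    rw [real_inner_self_eq_norm_sq, hγ.unitSpeed s hs.1, one_pow]
  have hNN : (inner ℝ (normal cov γ s) (normal cov γ s) : ℝ) = 1 := by
    rw [real_inner_self_eq_norm_sq, norm_normal hs, one_pow]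
  have hTN := hγ.inner_velocity_normal hcov hJ hs.1
  have hNT := (real_inner_comm _ _).trans hTN
  have hBT := hB.orthTangent s hs
  have hTB := (real_inner_comm _ _).trans hBT
  have hNB := (real_inner_comm _ _).trans (hB.orthNormal s hs)
  have hz := hγ.triharmonic s hs.1
  rw [triTension, hcov.curvatureTensor_of_const hρ, hcov.curvatureTensor_of_const hρ, h5, h3 s hs,
    h2 s hs, h1 s hs, show iterCov cov γ 0 s = velocity I γ s from rfl] at hz
  -- The $T$-component is $-5$ times the first stated equation. In the $N$-component the two
  -- curvature terms contribute $\rho(\kappa''-\kappa^3-\kappa\tau^2)$ and $-\rho\kappa^3$.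
  have hzT := congrArg (fun v ↦ (inner ℝ (velocity I γ s) v : ℝ)) hz
  have hzN := congrArg (fun v ↦ (inner ℝ (normal cov γ s) v : ℝ)) hz
  simp only [frameField, inner_add_right, inner_sub_right, inner_smul_right, inner_add_left,
    inner_smul_left, conj_trivial, inner_zero_right, hTT, hNN, hTN, hNT, hBT, hTB, hNB,
    Pi.pow_apply, Pi.mul_apply] at hzT hzN
  push_cast at hzT hzN
  constructor
  · linear_combination (-1 / 5) * hzT
  · linear_combination hzN

end Frenet

/-! ### The two implications. -/

section Main

variable {E : Type*} [NormedAddCommGroup E] [NormedSpace ℝ E] [FiniteDimensional ℝ E]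
  {H : Type*} [TopologicalSpace H] {I : ModelWithCorners ℝ E H} [I.Boundaryless]
  {M : Type*} [TopologicalSpace M] [ChartedSpace H M] [IsManifold I ∞ M] [T2Space M]
  [RiemannianBundle (fun x : M ↦ TangentSpace I x)]
  [IsContMDiffRiemannianBundle I ∞ E (fun x : M ↦ TangentSpace I x)]
  {cov : CovariantDerivative I E (TangentSpace I : M → Type _)} {J : Set ℝ} {γ : ℝ → M}
  {B : ∀ t, TangentSpace I (γ t)} {ρ : ℝ}

theorem IsTriharmonicCurve.torsion_const_of_curvature_const (hE : Module.finrank ℝ E = 3)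
    (hγ : IsTriharmonicCurve cov J γ) (hcov : IsLeviCivita cov)
    (hρ : HasConstantSectionalCurvature cov ρ) (hJ : IsOpen J) (hJc : J.OrdConnected)
    (hB : IsBinormal cov J γ B) {κ₀ : ℝ} (hκ : ∀ s ∈ J, curvature cov γ s = κ₀) (h₀ : κ₀ ≠ 0) :
    ∀ x ∈ J, ∀ y ∈ J, torsion cov γ B x = torsion cov γ B y := by
  have hF : ∀ s ∈ J, s ∈ frenetSet cov J γ := fun s hs ↦ ⟨hs, by rwa [hκ s hs]⟩
  have hder : ∀ s ∈ J, HasDerivAt (torsion cov γ B) (deriv (torsion cov γ B) s) s :=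
    fun s hs ↦ hasDerivAt_iterate_deriv (hγ.contDiffAt_torsion hcov hJ hB (hF s hs)) 0
  have hsq := eq_of_hasDerivAt_zero hJ hJc.isPreconnected
    (f := fun s ↦ torsion cov γ B s ^ 2) fun s hs ↦ by
      refine ((hder s hs).pow 2).congr_deriv ?_
      have h := (hγ.frenet_equations hE hcov hρ hJ hB rfl rfl (hF s hs)).1
      have hz := iterate_deriv_eq_zero_of_const hJ hκ
      simp only [hz 0 s hs, hz 1 s hs, hz 2 s hs, Function.iterate_zero, id_eq, hκ s hs,
        Function.iterate_one] at h
      have h' : κ₀ ^ 2 * (torsion cov γ B s * deriv (torsion cov γ B) s) = 0 := by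
        linear_combination -h
      have := (mul_eq_zero.1 h').resolve_left (pow_ne_zero 2 h₀)
      push_cast
      linear_combination 2 * this
  intro x hx
  -- Constancy of the square leaves two possible values, opposite to each other; continuity on the
  -- interval selects one.
  refine eq_of_continuousOn_of_finite hJc.isPreconnected
    (fun s hs ↦ (hder s hs).continuousAt.continuousWithinAt)
    (A := {torsion cov γ B x, -torsion cov γ B x}) (toFinite _) (fun s hs ↦ ?_) x hx
  exact sq_eq_sq_iff_eq_or_eq_neg.1 (hsq s hs x hx)

theorem IsTriharmonicCurve.curvature_const_of_torsion_const (hE : Module.finrank ℝ E = 3)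
    (hγ : IsTriharmonicCurve cov J γ) (hcov : IsLeviCivita cov)
    (hρ : HasConstantSectionalCurvature cov ρ) (hJ : IsOpen J) (hJc : J.OrdConnected)
    (hB : IsBinormal cov J γ B) {τ₀ : ℝ}
    (hτ : ∀ s ∈ frenetSet cov J γ, torsion cov γ B s = τ₀) :
    ∃ κ₀ : ℝ, ∀ s ∈ J, curvature cov γ s = κ₀ := by
  have hFo := hγ.isOpen_frenetSet hcov hJ
  have hloc : ∀ s ∈ frenetSet cov J γ, ∀ᶠ t in 𝓝 s, curvature cov γ t = curvature cov γ s := by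
    intro s hs
    -- The Frenet set may be disconnected, so the ODE lemma is applied on a ball inside it.
    obtain ⟨ε, hε, hsub⟩ := Metric.isOpen_iff.1 hFo s hs
    have hd : ∀ i, ∀ t ∈ Metric.ball s ε, HasDerivAt (deriv^[i] (curvature cov γ))
        (deriv^[i + 1] (curvature cov γ) t) t := fun i t ht ↦
      hasDerivAt_iterate_deriv (hγ.contDiffAt_curvature hcov hJ (hsub ht)) i
    have hz := iterate_deriv_eq_zero_of_const hFo hτ
    have key := curvature_ode_const Metric.isOpen_ball (convex_ball s ε).isPreconnected
      (τ := τ₀) (ρ := ρ) (hd 0) (hd 1) (hd 2) (hd 3) (fun t ht ↦ ?_) (fun t ht ↦ ?_)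
    · filter_upwards [Metric.ball_mem_nhds s hε] with t ht
      exact key t ht s (Metric.mem_ball_self hε)
    all_goals
      have h := hγ.frenet_equations hE hcov hρ hJ hB rfl rfl (hsub ht)
      have h0 : deriv^[0] (torsion cov γ B) t = τ₀ := hτ t (hsub ht)
      simp only [hz 0 t (hsub ht), hz 1 t (hsub ht), h0] at h
    · linear_combination h.1
    · linear_combination h.2
  rcases (frenetSet cov J γ).eq_empty_or_nonempty with hF | ⟨x, hx⟩
  · refine ⟨0, fun s hs ↦ ?_⟩
    by_contra hne
    exact (hF ▸ (⟨hs, hne⟩ : s ∈ frenetSet cov J γ) : s ∈ (∅ : Set ℝ))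
  refine ⟨curvature cov γ x, fun s hs ↦ ?_⟩
  -- Where the curvature equals its nonzero value at `x`, the point lies in the Frenet set and the
  -- curvature is locally constant there. Hence the disjoint open sets `u` and `v` cover `J`, and
  -- `J` lies in `u`.
  let u : Set ℝ := {t | ∀ᶠ r in 𝓝 t, curvature cov γ r = curvature cov γ x}
  let v : Set ℝ := {t ∈ J | curvature cov γ t ≠ curvature cov γ x}
  have hv : IsOpen v := isOpen_iff_mem_nhds.2 fun t ht ↦ by
    filter_upwards [hJ.mem_nhds ht.1,
      (hγ.continuousAt_curvature hcov hJ ht.1).eventually_ne ht.2] with r h1 h2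
    exact ⟨h1, h2⟩
  have huv : J ⊆ u ∪ v := fun t ht ↦ by
    by_cases h : curvature cov γ t = curvature cov γ x
    · exact Or.inl ((hloc t ⟨ht, h ▸ hx.2⟩).mono fun r hr ↦ hr.trans h)
    · exact Or.inr ⟨ht, h⟩
  have hdis : Disjoint u v :=
    Set.disjoint_left.2 fun t htu htv ↦ htv.2 htu.self_of_nhds
  exact (hJc.isPreconnected.subset_left_of_subset_union isOpen_setOfPred_eventually_nhds hv hdis huv
    ⟨x, hx.1, hloc x hx⟩ hs : s ∈ u).self_of_nhds

end Main

end TriharmonicCurves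

end

theorem mainTheorem5
    {M : Type*} [TopologicalSpace M] [T2Space M] [ChartedSpace (EuclideanSpace ℝ (Fin 3)) M]
    [IsManifold (𝓡 3) ∞ M]
    [RiemannianBundle (fun x : M ↦ TangentSpace (𝓡 3) x)]
    [IsContMDiffRiemannianBundle (𝓡 3) ∞ (EuclideanSpace ℝ (Fin 3))
      (fun x : M ↦ TangentSpace (𝓡 3) x)]
    (cov : CovariantDerivative (𝓡 3) (EuclideanSpace ℝ (Fin 3))
      (TangentSpace (𝓡 3) : M → Type _))
    (hcov : TriharmonicCurves.IsLeviCivita cov)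
    (ρ : ℝ) (hρ : TriharmonicCurves.HasConstantSectionalCurvature cov ρ)
    (J : Set ℝ) (hJo : IsOpen J) (hJc : J.OrdConnected)
    (γ : ℝ → M) (hγ : TriharmonicCurves.IsProperTriharmonicCurve cov J γ)
    (B : ∀ s, TangentSpace (𝓡 3) (γ s)) (hB : TriharmonicCurves.IsBinormal cov J γ B) :
    (∃ κ₀ : ℝ, ∀ s ∈ J, TriharmonicCurves.curvature cov γ s = κ₀) ↔
      (∃ τ₀ : ℝ, ∀ s ∈ TriharmonicCurves.frenetSet cov J γ,
        TriharmonicCurves.torsion cov γ B s = τ₀) := by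
  have hE : Module.finrank ℝ (EuclideanSpace ℝ (Fin 3)) = 3 := by simp
  constructor
  · rintro ⟨κ₀, hκ⟩
    have h₀ : κ₀ ≠ 0 := by
      rintro rfl
      exact hγ.2 fun s hs ↦ norm_eq_zero.1 (hκ s hs)
    rcases J.eq_empty_or_nonempty with rfl | ⟨x, hx⟩
    · exact ⟨0, fun s hs ↦ hs.1.elim⟩
    · exact ⟨_, fun s hs ↦ hγ.1.torsion_const_of_curvature_const hE hcov hρ hJo hJc hB hκ h₀
        s hs.1 x hx⟩
  · rintro ⟨τ₀, hτ⟩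
    exact hγ.1.curvature_const_of_torsion_const hE hcov hρ hJo hJc hB hτ
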